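/- Let $S$ be a countable set and let $(X_t)_{t\ge 0}$ be a time-homogeneous Markov process on $S$ with transition rates $(a(i,j))_{i,j\in S}$ (finite total jump rate $\sum_{j\ne i}a(i,j)$ in each state; no symmetry is assumed) and transition probabilities $p_t(i,j)=\mathbb{P}[X_t=j\mid X_0=i]$. Fix $i\in S$, let the process start in $X_0=i$, and let $L_t=\int_0^t \mathbf 1_{\{X_s=i\}}\,ds$ be its local time in $i$. Put $$G_\infty=\int_0^\infty p_t(i,i)\,dt,\qquad H_\infty=\int_0^\infty t\,p_t(i,i)\,dt ,$$ and write $h_1\sim h_2$ for $\lim h_1/h_2=1$. Suppose that $p_t(i,i)\sim c\,t^{-\alpha}$ as $t\to\infty$, where $c>0$ and $\alpha>1$ (so that $0<G_\infty<\infty$), and let $\kappa=1/G_\infty$. Then, as $t\to\infty$, $$\mathbb{E}\big[e^{\kappa L_t}\big]\sim\begin{cases} \dfrac{\alpha-1}{\kappa\, c\,\Gamma(2-\alpha)\,\Gamma(\alpha)}\;t^{\alpha-1} &: 1<\alpha<2,\\[2mm] \dfrac{1}{\kappa c}\;\dfrac{t}{\log t} &: \alpha=2,\\[2mm] \dfrac{1}{\kappa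 H_\infty}\;t &: \alpha>2,\end{cases}$$ where in the last case $H_\infty<\infty$. -/

import Mathlib

open MeasureTheory Filter Asymptotics
open scoped NNReal ENNReal

namespace CriticalLocalTime

variable {S : Type*}

open scoped Classical in
/-- An honest (stochastic) transition function `p t i j` on the state space `S`. -/
structure IsTransitionFunction (p : ℝ≥0 → S → S → ℝ) : Prop where
  nonneg : ∀ t i j, 0 ≤ p t i j
  hasSum_one : ∀ t i, HasSum (fun j => p t i j) 1
  zero : ∀ i j, p 0 i j = if i = j then 1 else 0
  chapman_kolmogorov : ∀ s t i j, HasSum (fun k => p s i k * p t k j) (p (s + t) i j)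

/-- The transition function `p` has transition rates `a i j` (`i ≠ j`), with finite total jump
rate in every state: these are the right derivatives of `p` at time `0`. The diagonal
entries `a i i` play no role for the dynamics. -/
structure HasTransitionRates (a : S → S → ℝ) (p : ℝ≥0 → S → S → ℝ) : Prop where
  nonneg : ∀ i j, j ≠ i → 0 ≤ a i j
  summable : ∀ i, Summable (fun j : {j : S // j ≠ i} => a i j)
  offDiag : ∀ i j, j ≠ i →
    HasDerivWithinAt (fun t : ℝ => p t.toNNReal i j) (a i j) (Set.Ici 0) 0
  diag : ∀ i,
    HasDerivWithinAt (fun t : ℝ => p t.toNNReal i i) (-∑' j : {j : S // j ≠ i}, a i j)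
      (Set.Ici 0) 0

open scoped Classical in
/-- `X` is, under `P`, a (jointly measurable) time-homogeneous Markov process with transition
function `p` started in `i`: its finite-dimensional distributions are
`P(X_0 = x_0, X_{t_1} = x_1, …, X_{t_n} = x_n) = 1_{x_0 = i} ∏ p_{t_{k+1} - t_k}(x_k, x_{k+1})`
for `0 = t_0 ≤ t_1 ≤ … ≤ t_n`. Joint measurability holds in particular when the paths are
right-continuous for the discrete topology of `S`. -/
structure IsMarkovProcess {Ω : Type*} [MeasurableSpace Ω] [MeasurableSpace S] (P : Measure Ω)
    (X : ℝ≥0 → Ω → S) (p : ℝ≥0 → S → S → ℝ) (i : S) : Prop where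
  measurable : Measurable (fun z : ℝ≥0 × Ω => X z.1 z.2)
  finiteDim : ∀ (n : ℕ) (t : Fin (n + 1) → ℝ≥0) (x : Fin (n + 1) → S), Monotone t → t 0 = 0 →
    P {ω | ∀ k, X (t k) ω = x k} =
      ENNReal.ofReal ((if x 0 = i then 1 else 0) *
        ∏ k : Fin n, p (t k.succ - t k.castSucc) (x k.castSucc) (x k.succ))

open scoped Classical in
/-- The local time `L_t = ∫_0^t 1_{X_s = i} ds` of `X` in the state `i`. -/
noncomputable def localTime {Ω : Type*} (X : ℝ≥0 → Ω → S) (i : S) (t : ℝ≥0) (ω : Ω) : ℝ :=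
  ∫ s in (0 : ℝ)..t, if X s.toNNReal ω = i then (1 : ℝ) else 0

/-- The Green function `G_∞(i,j) = ∫_0^∞ p_t(i,j) dt`, possibly infinite. -/
noncomputable def greenFunction (p : ℝ≥0 → S → S → ℝ) (i j : S) : ℝ≥0∞ :=
  ∫⁻ t in Set.Ici (0 : ℝ), ENNReal.ofReal (p t.toNNReal i j)

/-- `H_∞(i,j) = ∫_0^∞ t p_t(i,j) dt`, possibly infinite. -/
noncomputable def weightedGreenFunction (p : ℝ≥0 → S → S → ℝ) (i j : S) : ℝ≥0∞ :=
  ∫⁻ t in Set.Ici (0 : ℝ), ENNReal.ofReal (t * p t.toNNReal i j)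

end CriticalLocalTime

/-!
Along each path, `e^{κ L_t} = 1 + κ ∫_0^t 1_{X_s = i} e^{κ (L_t - L_s)} ds`. Taking expectations
and using the Markov property at time `s`, `M(t) = E[e^{κ L_t}]` solves the renewal equation
`M = 1 + φ * M` with `φ(t) = κ p_t(i,i)`, which is a probability density as `κ = 1 / G_∞`. Hence
the Laplace transform of `M` at `s` is `1 / (s (1 - φ̂(s)))`. The defect `1 - φ̂(s)` equals `s`
times the Laplace transform of the tail `∫_t^∞ φ ~ (κ c / (α - 1)) t^{1 - α}`, which as `s → 0` is
of order `s^{α - 1}` for `1 < α < 2`, of order `s log(1/s)` for `α = 2`, and of order `s` when `φ`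
has a finite mean. In each case the defect is regularly varying at `0`, and since `M` is monotone,
Karamata's Tauberian theorem carries the asymptotics of its Laplace transform back to `M`.
-/

namespace CriticalLocalTime

open Set Topology

section PathwiseIdentity

lemma absolutelyContinuousOnInterval_comp_of_contDiff {F f : ℝ → ℝ} {a b : ℝ}
    (hF : ContDiff ℝ 1 F) (hf : AbsolutelyContinuousOnInterval f a b) :
    AbsolutelyContinuousOnInterval (fun s => F (f s)) a b := by
  obtain ⟨R, hR⟩ := hf.exists_bound
  obtain ⟨K, hK⟩ := hF.contDiffOn.exists_lipschitzOnWith one_ne_zero (convex_Icc (-R) R)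
    isCompact_Icc
  rw [AbsolutelyContinuousOnInterval] at hf ⊢
  refine squeeze_zero' (.of_forall fun E => by positivity) ?_ (by simpa using hf.const_mul (K : ℝ))
  filter_upwards [mem_inf_of_right (mem_principal_self _)] with E hE
  rw [Finset.mul_sum]
  gcongr with k hk
  exact hK.dist_le_mul _ (abs_le.1 (hR _ (hE.1 k hk).1)) _ (abs_le.1 (hR _ (hE.1 k hk).2))

lemma exp_intervalIntegral_eq {g : ℝ → ℝ} {a b : ℝ} (hg : IntervalIntegrable g volume a b) :
    Real.exp (∫ u in a..b, g u) = 1 + ∫ s in a..b, g s * Real.exp (∫ u in s..b, g u) := by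
  have hac : AbsolutelyContinuousOnInterval (fun s => Real.exp (-∫ u in b..s, g u)) a b :=
    absolutelyContinuousOnInterval_comp_of_contDiff (F := fun x => Real.exp (-x))
      (Real.contDiff_exp.comp contDiff_neg)
      (hg.absolutelyContinuousOnInterval_intervalIntegral right_mem_uIcc)
  have hderiv : ∫ s in a..b, deriv (fun s => Real.exp (-∫ u in b..s, g u)) s =
      -∫ s in a..b, g s * Real.exp (-∫ u in b..s, g u) := by
    rw [← intervalIntegral.integral_neg]
    refine intervalIntegral.integral_congr_ae ?_
    filter_upwards [hg.ae_hasDerivAt_integral] with s hs hs_mem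
    rw [(hs (uIoc_subset_uIcc hs_mem) b right_mem_uIcc).fun_neg.exp.deriv]
    ring
  have hftc := hac.integral_deriv_eq_sub
  rw [hderiv, intervalIntegral.integral_same, neg_zero, Real.exp_zero] at hftc
  simp only [intervalIntegral.integral_symm b, neg_neg] at hftc ⊢
  linarith

end PathwiseIdentity

section ExponentialMoments

variable {T Ω Ω' : Type*} [MeasurableSpace T] [MeasurableSpace Ω] [MeasurableSpace Ω']
  {ν : Measure T} [IsFiniteMeasure ν] {μ : Measure Ω} [IsFiniteMeasure μ]
  {μ' : Measure Ω'} [IsFiniteMeasure μ']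

lemma hasSum_integral_exp {Z : Ω → ℝ} (hZ : AEStronglyMeasurable Z μ) {B : ℝ}
    (hB : ∀ ω, |Z ω| ≤ B) (κ : ℝ) :
    HasSum (fun n : ℕ => κ ^ n / n.factorial * ∫ ω, Z ω ^ n ∂μ)
      (∫ ω, Real.exp (κ * Z ω) ∂μ) := by
  simp_rw [← integral_const_mul]
  refine hasSum_integral_of_dominated_convergence (fun n _ => (|κ| * B) ^ n / n.factorial)
    (fun n => by fun_prop) (fun n => .of_forall fun ω => ?_)
    (.of_forall fun _ => Real.summable_pow_div_factorial _) (by simp) (.of_forall fun ω => ?_)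
  · rw [norm_mul, norm_div, norm_pow, norm_pow, Real.norm_natCast, Real.norm_eq_abs,
      Real.norm_eq_abs, mul_pow, div_mul_eq_mul_div]
    gcongr
    exact hB ω
  · have hexp := NormedSpace.expSeries_div_hasSum_exp (κ * Z ω)
    rw [← Real.exp_eq_exp_ℝ] at hexp
    refine hexp.congr_fun fun n => ?_
    rw [mul_pow]; ring

lemma integral_pow_integral {Y : T → Ω → ℝ} (hY : Measurable (Function.uncurry Y)) {B : ℝ}
    (hB : ∀ u ω, |Y u ω| ≤ B) (n : ℕ) :
    ∫ ω, (∫ u, Y u ω ∂ν) ^ n ∂μ =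
      ∫ u : Fin n → T, ∫ ω, ∏ k, Y (u k) ω ∂μ ∂(Measure.pi fun _ => ν) := by
  have hprod : Measurable fun z : Ω × (Fin n → T) => ∏ k, Y (z.2 k) z.1 :=
    Finset.measurable_prod _ fun k _ => hY.comp
      (f := fun z : Ω × (Fin n → T) => (z.2 k, z.1))
      (((measurable_pi_apply k).comp measurable_snd).prodMk measurable_fst)
  rw [← integral_integral_swap]
  · refine integral_congr_ae (.of_forall fun ω => ?_)
    simp only [integral_fintype_prod_eq_pow (ι := Fin n) (fun u => Y u ω), Fintype.card_fin]
  · refine Integrable.of_bound hprod.aestronglyMeasurable (B ^ n) (.of_forall fun z => ?_)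
    rw [Function.uncurry, norm_prod]
    simpa using Finset.prod_le_prod (s := Finset.univ) (fun k _ => norm_nonneg (Y (z.2 k) z.1))
      fun k _ => hB (z.2 k) z.1

lemma hasSum_integral_exp_integral {Y : T → Ω → ℝ} (hY : Measurable (Function.uncurry Y)) {B : ℝ}
    (hB : ∀ u ω, |Y u ω| ≤ B) (κ : ℝ) :
    HasSum (fun n : ℕ => κ ^ n / n.factorial *
        ∫ u : Fin n → T, ∫ ω, ∏ k, Y (u k) ω ∂μ ∂(Measure.pi fun _ => ν))
      (∫ ω, Real.exp (κ * ∫ u, Y u ω ∂ν) ∂μ) := by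
  simp_rw [← integral_pow_integral hY hB]
  refine hasSum_integral_exp (B := B * ν.real univ) ?_ (fun ω => ?_) κ
  · exact (hY.stronglyMeasurable.integral_prod_left (μ := ν)).aestronglyMeasurable
  · exact norm_integral_le_of_norm_le_const (f := fun u => Y u ω) (.of_forall fun u => hB u ω)

lemma integral_exp_integral_congr {Y : T → Ω → ℝ} {Y' : T → Ω' → ℝ}
    (hY : Measurable (Function.uncurry Y)) (hY' : Measurable (Function.uncurry Y'))
    {B : ℝ} (hB : ∀ u ω, |Y u ω| ≤ B) (hB' : ∀ u ω, |Y' u ω| ≤ B)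
    (hmoments : ∀ n : ℕ, ∀ᵐ u : Fin n → T ∂(Measure.pi fun _ => ν),
      ∫ ω, ∏ k, Y (u k) ω ∂μ = ∫ ω, ∏ k, Y' (u k) ω ∂μ') (κ : ℝ) :
    ∫ ω, Real.exp (κ * ∫ u, Y u ω ∂ν) ∂μ = ∫ ω, Real.exp (κ * ∫ u, Y' u ω ∂ν) ∂μ' := by
  refine (hasSum_integral_exp_integral hY hB κ).unique ?_
  simp_rw [fun n => integral_congr_ae (hmoments n)]
  exact hasSum_integral_exp_integral hY' hB' κ

end ExponentialMoments

section MarkovProcess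

variable {S Ω : Type*} {X : ℝ≥0 → Ω → S} {i : S}

open scoped Classical in
/-- The indicator of the event `X_s = i`. Times are real, negative ones being truncated to `0`, so
that this is the integrand of `localTime`. -/
noncomputable def visitIndicator (X : ℝ≥0 → Ω → S) (i : S) (s : ℝ) (ω : Ω) : ℝ :=
  if X s.toNNReal ω = i then 1 else 0

lemma visitIndicator_nonneg (s : ℝ) (ω : Ω) : 0 ≤ visitIndicator X i s ω := by
  rw [visitIndicator]; positivity

lemma abs_visitIndicator_le_one (s : ℝ) (ω : Ω) : |visitIndicator X i s ω| ≤ 1 := by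
  rw [visitIndicator]; split_ifs <;> simp

lemma abs_integral_visitIndicator_le (a b : ℝ) (ω : Ω) :
    |∫ s in a..b, visitIndicator X i s ω| ≤ |b - a| := by
  simpa using intervalIntegral.norm_integral_le_of_norm_le_const (a := a) (b := b)
    (f := fun s => visitIndicator X i s ω) fun s _ => abs_visitIndicator_le_one s ω

lemma exp_mul_integral_visitIndicator_le (κ a b : ℝ) (ω : Ω) :
    Real.exp (κ * ∫ s in a..b, visitIndicator X i s ω) ≤ Real.exp (|κ| * |b - a|) := by
  refine Real.exp_le_exp.2 ((le_abs_self _).trans ?_)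
  rw [abs_mul]
  exact mul_le_mul_of_nonneg_left (abs_integral_visitIndicator_le a b ω) (abs_nonneg κ)

lemma prod_visitIndicator {n : ℕ} (u : Fin n → ℝ) (ω : Ω) :
    ∏ k, visitIndicator X i (u k) ω =
      {ω | ∀ k, X (u k).toNNReal ω = i}.indicator (1 : Ω → ℝ) ω := by
  classical
  simp only [visitIndicator, Finset.prod_ite_zero, Finset.prod_const_one, indicator,
    Finset.mem_univ, true_implies, mem_ofPred_eq, Pi.one_apply]

/-- The exponential moment `E[e^{κ L_t}]` of the local time in `i`, as a function of a real `t`. -/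
noncomputable def expMoment [MeasurableSpace Ω] (P : Measure Ω) (X : ℝ≥0 → Ω → S) (i : S)
    (κ t : ℝ) : ℝ :=
  ∫ ω, Real.exp (κ * ∫ s in (0 : ℝ)..t, visitIndicator X i s ω) ∂P

lemma monotone_cons_zero {n : ℕ} {u : Fin n → ℝ≥0} (hu : Monotone u) :
    Monotone (Fin.cons 0 u : Fin (n + 1) → ℝ≥0) := by
  intro a b hab
  cases a using Fin.cases with
  | zero => exact zero_le
  | succ a =>
    cases b using Fin.cases with
    | zero => simp at hab
    | succ b => exact hu (Fin.succ_le_succ_iff.1 hab)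

namespace IsMarkovProcess

variable [MeasurableSpace S] [MeasurableSingletonClass S] [MeasurableSpace Ω] {P : Measure Ω}
  {p : ℝ≥0 → S → S → ℝ}

lemma measurable_visitIndicator (hX : IsMarkovProcess P X p i) :
    Measurable (Function.uncurry (visitIndicator X i)) := by
  classical
  refine Measurable.ite ?_ measurable_const measurable_const
  exact hX.measurable.comp (f := fun z : ℝ × Ω => (z.1.toNNReal, z.2)) (by fun_prop)
    (measurableSet_singleton i)

lemma intervalIntegrable_visitIndicator (hX : IsMarkovProcess P X p i) (ω : Ω) (a b : ℝ) :
    IntervalIntegrable (fun s => visitIndicator X i s ω) volume a b :=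
  (intervalIntegrable_const (c := (1 : ℝ))).mono_fun
    (hX.measurable_visitIndicator.comp measurable_prodMk_right).aestronglyMeasurable
    (.of_forall fun s => by simpa using abs_visitIndicator_le_one s ω)

lemma measurable_integral_visitIndicator (hX : IsMarkovProcess P X p i) (t : ℝ) :
    Measurable fun z : ℝ × Ω => ∫ u in z.1..t, visitIndicator X i u z.2 := by
  refine measurable_uncurry_of_continuous_of_measurable
    (u := fun s ω => ∫ u in s..t, visitIndicator X i u ω) (fun ω => ?_) (fun s => ?_)
  · simp only [intervalIntegral.integral_symm t]
    exact (intervalIntegral.continuous_primitive (hX.intervalIntegrable_visitIndicator ω) t).neg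
  · have hset (A : Set ℝ) : StronglyMeasurable fun ω => ∫ u in A, visitIndicator X i u ω :=
      hX.measurable_visitIndicator.stronglyMeasurable.integral_prod_left
    exact ((hset _).sub (hset _)).measurable

lemma measurableSet_forall_eq (hX : IsMarkovProcess P X p i) {n : ℕ} (u : Fin n → ℝ≥0) :
    MeasurableSet {ω | ∀ k, X (u k) ω = i} := by
  rw [ofPred_forall]
  exact MeasurableSet.iInter fun k => hX.measurable.of_uncurry_left (measurableSet_singleton i)

lemma measurableSet_eq (hX : IsMarkovProcess P X p i) (s : ℝ≥0) :
    MeasurableSet {ω | X s ω = i} := by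
  simpa using hX.measurableSet_forall_eq (n := 1) fun _ => s

section FiniteDimensional

variable [IsProbabilityMeasure P]

lemma ae_zero_eq (hX : IsMarkovProcess P X p i) : ∀ᵐ ω ∂P, X 0 ω = i := by
  have hprob : P {ω | X 0 ω = i} = 1 := by
    simpa using hX.finiteDim 0 (fun _ => 0) (fun _ => i) monotone_const rfl
  rwa [← mem_ae_iff_prob_eq_one (hX.measurableSet_eq 0)] at hprob

lemma measure_forall_eq_of_monotone (hX : IsMarkovProcess P X p i) {n : ℕ} {u : Fin n → ℝ≥0}
    (hu : Monotone u) :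
    P {ω | ∀ k, X (u k) ω = i} = ENNReal.ofReal
      (∏ k : Fin n, p (u k - (Fin.cons 0 u : Fin (n + 1) → ℝ≥0) k.castSucc) i i) := by
  have hcons : Monotone (Fin.cons 0 u : Fin (n + 1) → ℝ≥0) :=
    monotone_cons_zero hu
  have hdist := hX.finiteDim n (Fin.cons 0 u) (fun _ => i) hcons rfl
  rw [if_pos rfl, one_mul] at hdist
  simp only [Fin.cons_succ] at hdist
  rw [← hdist]
  refine measure_congr ?_
  filter_upwards [hX.ae_zero_eq] with ω hω
  refine propext ?_
  change (∀ k, X (u k) ω = i) ↔ ∀ k : Fin (n + 1), X ((Fin.cons 0 u : Fin (n + 1) → ℝ≥0) k) ω = i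
  simp [Fin.forall_fin_succ, hω]

lemma measure_eq (hX : IsMarkovProcess P X p i) (s : ℝ≥0) :
    P {ω | X s ω = i} = ENNReal.ofReal (p s i i) := by
  simpa using hX.measure_forall_eq_of_monotone (n := 1) (u := fun _ => s) monotone_const

lemma measure_eq_and_forall_add_eq_of_monotone (hX : IsMarkovProcess P X p i)
    (hp : IsTransitionFunction p) {n : ℕ} (s : ℝ≥0) {u : Fin n → ℝ≥0} (hu : Monotone u) :
    P {ω | X s ω = i ∧ ∀ k, X (s + u k) ω = i} =
      ENNReal.ofReal (p s i i) * P {ω | ∀ k, X (u k) ω = i} := by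
  have hcons : (Fin.cons s (fun k => s + u k) : Fin (n + 1) → ℝ≥0) =
      fun k => s + (Fin.cons 0 u : Fin (n + 1) → ℝ≥0) k := by
    ext k
    cases k using Fin.cases <;> simp
  have hmono : Monotone (Fin.cons s (fun k => s + u k) : Fin (n + 1) → ℝ≥0) := by
    rw [hcons]
    exact (monotone_cons_zero hu).const_add s
  have hset : {ω | X s ω = i ∧ ∀ k, X (s + u k) ω = i} =
      {ω | ∀ k, X ((Fin.cons s (fun k => s + u k) : Fin (n + 1) → ℝ≥0) k) ω = i} := by
    ext ω
    simp [Fin.forall_fin_succ]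
  rw [hset, hX.measure_forall_eq_of_monotone hmono, hX.measure_forall_eq_of_monotone hu,
    ← ENNReal.ofReal_mul (hp.nonneg _ _ _), Fin.prod_univ_succ]
  congr 2
  · simp
  · refine Finset.prod_congr rfl fun k _ => ?_
    rw [← Fin.succ_castSucc, Fin.cons_succ, Fin.cons_succ, hcons, add_tsub_add_eq_tsub_left]

lemma measure_eq_and_forall_add_eq (hX : IsMarkovProcess P X p i) (hp : IsTransitionFunction p)
    {n : ℕ} (s : ℝ≥0) (u : Fin n → ℝ≥0) :
    P {ω | X s ω = i ∧ ∀ k, X (s + u k) ω = i} =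
      ENNReal.ofReal (p s i i) * P {ω | ∀ k, X (u k) ω = i} := by
  have hsort (r : ℝ≥0) (ω : Ω) :
      (∀ k, X (r + u (Tuple.sort u k)) ω = i) ↔ ∀ k, X (r + u k) ω = i :=
    (Tuple.sort u).forall_congr_right (q := fun k => X (r + u k) ω = i)
  have hsort_zero (ω : Ω) : (∀ k, X (u (Tuple.sort u k)) ω = i) ↔ ∀ k, X (u k) ω = i := by
    simpa only [zero_add] using hsort 0 ω
  simpa only [Function.comp_apply, hsort, hsort_zero] using
    hX.measure_eq_and_forall_add_eq_of_monotone hp s (Tuple.monotone_sort u)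

end FiniteDimensional

section RenewalEquation

lemma integrable_visitIndicator_mul_exp [IsFiniteMeasure P] (hX : IsMarkovProcess P X p i)
    (κ t : ℝ) :
    Integrable (Function.uncurry fun (s : ℝ) (ω : Ω) => visitIndicator X i s ω *
      Real.exp (κ * ∫ u in s..t, visitIndicator X i u ω))
      ((volume.restrict (uIoc 0 t)).prod P) := by
  have : IsFiniteMeasure (volume.restrict (uIoc 0 t)) := by rw [uIoc]; infer_instance
  refine Integrable.of_bound (C := Real.exp (|κ| * |t|)) ?_ ?_
  · exact (hX.measurable_visitIndicator.mul (Real.measurable_exp.comp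
      ((hX.measurable_integral_visitIndicator t).const_mul κ))).aestronglyMeasurable
  · filter_upwards [Measure.quasiMeasurePreserving_fst.ae (ae_restrict_mem measurableSet_uIoc)]
      with ⟨s, ω⟩ (hs : s ∈ uIoc 0 t)
    rw [Function.uncurry_apply_pair, norm_mul, Real.norm_eq_abs,
      Real.norm_of_nonneg (Real.exp_pos _).le]
    refine (mul_le_of_le_one_left (by positivity) (abs_visitIndicator_le_one s ω)).trans
      ((exp_mul_integral_visitIndicator_le κ s t ω).trans ?_)
    have hdist := abs_sub_right_of_mem_uIcc (uIoc_subset_uIcc hs)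
    rw [sub_zero] at hdist
    gcongr

variable [IsProbabilityMeasure P]

lemma integral_prod_visitIndicator_add (hX : IsMarkovProcess P X p i)
    (hp : IsTransitionFunction p) {s : ℝ} (hs : 0 ≤ s) {n : ℕ} {u : Fin n → ℝ} (hu : ∀ k, 0 ≤ u k) :
    ∫ ω, ∏ k, visitIndicator X i (s + u k) ω ∂(P.restrict {ω | X s.toNNReal ω = i}) =
      p s.toNNReal i i * ∫ ω, ∏ k, visitIndicator X i (u k) ω ∂P := by
  have hmeas := hX.measurableSet_forall_eq fun k => (s + u k).toNNReal
  simp only [prod_visitIndicator]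
  rw [integral_indicator_one hmeas, integral_indicator_one (hX.measurableSet_forall_eq _),
    measureReal_restrict_apply hmeas, measureReal_def, measureReal_def, inter_comm]
  simp only [Real.toNNReal_add hs (hu _)]
  change (P {ω | X s.toNNReal ω = i ∧ ∀ k, X (s.toNNReal + (u k).toNNReal) ω = i}).toReal = _
  rw [hX.measure_eq_and_forall_add_eq hp, ENNReal.toReal_mul,
    ENNReal.toReal_ofReal (hp.nonneg _ _ _)]

lemma setIntegral_exp_integral_visitIndicator_add (hX : IsMarkovProcess P X p i)
    (hp : IsTransitionFunction p) (κ : ℝ) {s t : ℝ} (hs : 0 ≤ s) (ht : 0 ≤ t) :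
    ∫ ω in {ω | X s.toNNReal ω = i}, Real.exp (κ * ∫ u in 0..t, visitIndicator X i (s + u) ω) ∂P =
      p s.toNNReal i i * expMoment P X i κ t := by
  have hfin : IsFiniteMeasure (ENNReal.ofReal (p s.toNNReal i i) • P) :=
    P.smul_finite ENNReal.ofReal_ne_top
  have hshift : Measurable (Function.uncurry fun u ω => visitIndicator X i (s + u) ω) :=
    hX.measurable_visitIndicator.comp (f := fun z : ℝ × Ω => (s + z.1, z.2)) (by fun_prop)
  have hcongr := integral_exp_integral_congr (ν := volume.restrict (Ioc 0 t))
    (μ := P.restrict {ω | X s.toNNReal ω = i}) (μ' := ENNReal.ofReal (p s.toNNReal i i) • P)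
    hshift hX.measurable_visitIndicator (fun _ _ => abs_visitIndicator_le_one _ _)
    (fun _ _ => abs_visitIndicator_le_one _ _) (fun n => ?_) κ
  · simpa only [expMoment, intervalIntegral.integral_of_le ht, integral_smul_measure,
      ENNReal.toReal_ofReal (hp.nonneg _ _ _), smul_eq_mul] using hcongr
  · have hpos : ∀ᵐ u ∂(Measure.pi fun _ : Fin n => volume.restrict (Ioc 0 t)), ∀ k, 0 < u k :=
      ae_all_iff.2 fun k => (Measure.quasiMeasurePreserving_eval _ k).ae
        ((ae_restrict_mem measurableSet_Ioc).mono fun _ hx => hx.1)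
    filter_upwards [hpos] with u hu
    rw [hX.integral_prod_visitIndicator_add hp hs fun k => (hu k).le, integral_smul_measure,
      ENNReal.toReal_ofReal (hp.nonneg _ _ _), smul_eq_mul]

lemma integral_visitIndicator_mul_exp (hX : IsMarkovProcess P X p i)
    (hp : IsTransitionFunction p) (κ : ℝ) {s t : ℝ} (hs : 0 ≤ s) (hst : s ≤ t) :
    ∫ ω, visitIndicator X i s ω * Real.exp (κ * ∫ u in s..t, visitIndicator X i u ω) ∂P =
      p s.toNNReal i i * expMoment P X i κ (t - s) := by
  rw [← hX.setIntegral_exp_integral_visitIndicator_add hp κ hs (sub_nonneg.2 hst),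
    ← integral_indicator (hX.measurableSet_eq _)]
  refine integral_congr_ae (.of_forall fun ω => ?_)
  have hshift := intervalIntegral.integral_comp_add_left (a := 0) (b := t - s)
    (fun u => visitIndicator X i u ω) s
  rw [add_zero, add_sub_cancel] at hshift
  beta_reduce
  rw [← hshift]
  by_cases hω : X s.toNNReal ω = i <;> simp [visitIndicator, hω]

theorem expMoment_eq (hX : IsMarkovProcess P X p i) (hp : IsTransitionFunction p) (κ : ℝ) {t : ℝ}
    (ht : 0 ≤ t) :
    expMoment P X i κ t =
      1 + ∫ s in 0..t, κ * p s.toNNReal i i * expMoment P X i κ (t - s) := by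
  have hpath (ω : Ω) := exp_intervalIntegral_eq
    ((hX.intervalIntegrable_visitIndicator ω 0 t).const_mul κ)
  simp only [intervalIntegral.integral_const_mul, mul_assoc κ] at hpath
  have hint := hX.integrable_visitIndicator_mul_exp κ t
  have hint_path : Integrable (fun ω => ∫ s in 0..t, visitIndicator X i s ω *
      Real.exp (κ * ∫ u in s..t, visitIndicator X i u ω)) P := by
    simpa only [Function.comp_apply, Prod.swap, Function.uncurry, uIoc_of_le ht,
      ← intervalIntegral.integral_of_le ht] using hint.swap.integral_prod_left
  calc expMoment P X i κ t
      = ∫ ω, (1 + κ * ∫ s in 0..t, visitIndicator X i s ω *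
          Real.exp (κ * ∫ u in s..t, visitIndicator X i u ω)) ∂P := by
        simp only [expMoment, hpath]
    _ = 1 + κ * ∫ s in 0..t, ∫ ω, visitIndicator X i s ω *
          Real.exp (κ * ∫ u in s..t, visitIndicator X i u ω) ∂P := by
        rw [integral_add (integrable_const _) (hint_path.const_mul κ), integral_const_mul,
          ← intervalIntegral_integral_swap hint]
        simp
    _ = 1 + ∫ s in 0..t, κ * p s.toNNReal i i * expMoment P X i κ (t - s) := by
        rw [← intervalIntegral.integral_const_mul]
        congr 1
        refine intervalIntegral.integral_congr fun s hs => ?_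
        rw [uIcc_of_le ht] at hs
        rw [hX.integral_visitIndicator_mul_exp hp κ hs.1 hs.2, mul_assoc]

end RenewalEquation

lemma integrable_exp_integral_visitIndicator [IsFiniteMeasure P] (hX : IsMarkovProcess P X p i)
    (κ t : ℝ) :
    Integrable (fun ω => Real.exp (κ * ∫ s in 0..t, visitIndicator X i s ω)) P := by
  refine Integrable.of_bound (C := Real.exp (|κ| * |t|)) ?_ (.of_forall fun ω => ?_)
  · exact (Real.measurable_exp.comp (((hX.measurable_integral_visitIndicator t).comp
      measurable_prodMk_left).const_mul κ)).aestronglyMeasurable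
  · rw [Real.norm_of_nonneg (Real.exp_pos _).le]
    simpa only [sub_zero] using exp_mul_integral_visitIndicator_le κ 0 t ω

lemma monotone_expMoment [IsFiniteMeasure P] (hX : IsMarkovProcess P X p i) {κ : ℝ}
    (hκ : 0 ≤ κ) : Monotone (expMoment P X i κ) := by
  intro s t hst
  refine integral_mono (hX.integrable_exp_integral_visitIndicator κ s)
    (hX.integrable_exp_integral_visitIndicator κ t) fun ω => ?_
  have hint := hX.intervalIntegrable_visitIndicator ω
  have hsplit := intervalIntegral.integral_add_adjacent_intervals (hint 0 s) (hint s t)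
  have hnonneg := intervalIntegral.integral_nonneg_of_forall (μ := volume) hst
    fun u => visitIndicator_nonneg (X := X) (i := i) u ω
  have hle : ∫ u in 0..s, visitIndicator X i u ω ≤ ∫ u in 0..t, visitIndicator X i u ω := by
    linarith
  dsimp only
  gcongr

lemma measurable_returnProbability [IsProbabilityMeasure P] (hX : IsMarkovProcess P X p i)
    (hp : IsTransitionFunction p) : Measurable fun t : ℝ => p t.toNNReal i i := by
  have hmeas : Measurable fun t : ℝ≥0 => P {ω | X t ω = i} :=
    measurable_measure_prodMk_left (hX.measurable (measurableSet_singleton i))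
  have htoReal : (fun t : ℝ≥0 => (P {ω | X t ω = i}).toReal) = fun t => p t i i := by
    ext t
    rw [hX.measure_eq, ENNReal.toReal_ofReal (hp.nonneg _ _ _)]
  exact (htoReal ▸ hmeas.ennreal_toReal).comp measurable_real_toNNReal

end IsMarkovProcess

end MarkovProcess

section Renewal

/-- The one-sided Laplace transform of a function on the half-line `(0, ∞)`. -/
noncomputable def laplaceTransform (f : ℝ → ℝ) (s : ℝ) : ℝ :=
  ∫ t in Ioi (0 : ℝ), Real.exp (-(s * t)) * f t

/-- The defect `f̂(0) - f̂(s)` of the Laplace transform of `f` at `s`, written as one integral. Its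
behaviour as `s → 0` reflects the tail of `f`. -/
noncomputable def laplaceDefect (f : ℝ → ℝ) (s : ℝ) : ℝ :=
  ∫ t in Ioi (0 : ℝ), (1 - Real.exp (-(s * t))) * f t

variable {f φ M : ℝ → ℝ} {s : ℝ}

lemma integrableOn_exp_neg_mul_mul (hf : IntegrableOn f (Ioi 0)) (hs : 0 ≤ s) :
    IntegrableOn (fun t => Real.exp (-(s * t)) * f t) (Ioi 0) := by
  refine Integrable.bdd_mul (c := 1) hf (by fun_prop) ?_
  filter_upwards [ae_restrict_mem measurableSet_Ioi] with t ht
  rw [Real.norm_of_nonneg (Real.exp_pos _).le, Real.exp_le_one_iff, neg_nonpos]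
  exact mul_nonneg hs (le_of_lt ht)

lemma integrableOn_one_sub_exp_neg_mul_mul (hf : IntegrableOn f (Ioi 0)) (hs : 0 ≤ s) :
    IntegrableOn (fun t => (1 - Real.exp (-(s * t))) * f t) (Ioi 0) := by
  simp only [sub_mul, one_mul]
  exact hf.sub (integrableOn_exp_neg_mul_mul hf hs)

lemma laplaceTransform_eq_integral_sub_laplaceDefect (hf : IntegrableOn f (Ioi 0)) (hs : 0 ≤ s) :
    laplaceTransform f s = (∫ t in Ioi (0 : ℝ), f t) - laplaceDefect f s := by
  simp only [laplaceTransform, laplaceDefect, sub_mul, one_mul]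
  rw [integral_sub hf (integrableOn_exp_neg_mul_mul hf hs), sub_sub_cancel]

lemma laplaceTransform_one (hs : 0 < s) : laplaceTransform (fun _ => 1) s = s⁻¹ := by
  simpa only [laplaceTransform, mul_one, neg_mul, mul_zero, Real.exp_zero, neg_div_neg_eq,
    one_div] using integral_exp_mul_Ioi (a := -s) (neg_neg_of_pos hs) 0

lemma laplaceDefect_pos (hf : ∀ t > 0, 0 ≤ f t) (hint : IntegrableOn f (Ioi 0))
    (hpos : 0 < ∫ t in Ioi (0 : ℝ), f t) (hs : 0 < s) : 0 < laplaceDefect f s := by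
  have hweight : ∀ t ∈ Ioi (0 : ℝ), 0 < 1 - Real.exp (-(s * t)) := fun t ht => by
    rw [sub_pos, Real.exp_lt_one_iff, neg_lt_zero]
    exact mul_pos hs ht
  have hmem := ae_restrict_mem (μ := (volume : Measure ℝ)) (measurableSet_Ioi (a := (0 : ℝ)))
  have hnonneg : 0 ≤ᵐ[volume.restrict (Ioi 0)] fun t => (1 - Real.exp (-(s * t))) * f t := by
    filter_upwards [hmem] with t ht using mul_nonneg (hweight t ht).le (hf t ht)
  refine (integral_nonneg_of_ae hnonneg).lt_of_ne fun hzero => hpos.ne' ?_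
  have hae := (integral_eq_zero_iff_of_nonneg_ae hnonneg
    (integrableOn_one_sub_exp_neg_mul_mul hint hs.le)).1 hzero.symm
  refine integral_eq_zero_of_ae ?_
  filter_upwards [hae, hmem] with t ht htpos
  exact (mul_eq_zero.1 ht).resolve_left (hweight t htpos).ne'

/-- `M` is a nondecreasing solution of the renewal equation `M = 1 + φ * M`, where `φ` is a
probability density on `(0, ∞)`. The values of `φ` and `M` on `(-∞, 0)` are irrelevant. -/
structure IsRenewalFunction (φ M : ℝ → ℝ) : Prop where
  density_nonneg : ∀ t > 0, 0 ≤ φ t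
  density_integrable : IntegrableOn φ (Ioi 0)
  density_integral : ∫ t in Ioi (0 : ℝ), φ t = 1
  monotoneOn : MonotoneOn M (Ici 0)
  renewal : ∀ t, 0 ≤ t → M t = 1 + ∫ s in (0 : ℝ)..t, φ s * M (t - s)

lemma le_div_of_le_add_integral {ψ m : ℝ → ℝ} {a T : ℝ} (hψ : ∀ t > 0, 0 ≤ ψ t)
    (hint : IntegrableOn ψ (Ioi 0)) (hlt : ∫ t in Ioi (0 : ℝ), ψ t < 1) (hT : 0 ≤ T)
    (hm : ∀ t ∈ Icc 0 T, 0 ≤ m t) (hbdd : BddAbove (m '' Icc 0 T))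
    (hle : ∀ t ∈ Icc 0 T, m t ≤ a + ∫ s in (0 : ℝ)..t, ψ s * m (t - s)) :
    m T ≤ a / (1 - ∫ t in Ioi (0 : ℝ), ψ t) := by
  set B := sSup (m '' Icc 0 T)
  have hmB : ∀ t ∈ Icc 0 T, m t ≤ B := fun t ht => le_csSup hbdd (mem_image_of_mem m ht)
  have hTmem : T ∈ Icc 0 T := right_mem_Icc.2 hT
  have hB : 0 ≤ B := (hm T hTmem).trans (hmB T hTmem)
  have hconv : ∀ t ∈ Icc 0 T, ∫ s in (0 : ℝ)..t, ψ s * m (t - s) ≤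
      (∫ s in Ioi (0 : ℝ), ψ s) * B := fun t ht => by
    have hsub : ∀ s ∈ Ioc 0 t, t - s ∈ Icc 0 T := fun s hs =>
      ⟨sub_nonneg.2 hs.2, by linarith [hs.1, ht.2]⟩
    rw [intervalIntegral.integral_of_le ht.1, ← integral_mul_const]
    refine (integral_mono_of_nonneg (g := fun s => ψ s * B) ?_
      ((hint.mono_set Ioc_subset_Ioi_self).mul_const B) ?_).trans
      (setIntegral_mono_set (hint.mul_const B) ?_ Ioc_subset_Ioi_self.eventuallyLE)
    · filter_upwards [ae_restrict_mem measurableSet_Ioc] with s hs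
      exact mul_nonneg (hψ s hs.1) (hm _ (hsub s hs))
    · filter_upwards [ae_restrict_mem measurableSet_Ioc] with s hs
      exact mul_le_mul_of_nonneg_left (hmB _ (hsub s hs)) (hψ s hs.1)
    · filter_upwards [ae_restrict_mem measurableSet_Ioi] with s hs using mul_nonneg (hψ s hs) hB
  have hBle : B ≤ a + (∫ s in Ioi (0 : ℝ), ψ s) * B := by
    refine csSup_le ⟨m T, mem_image_of_mem m hTmem⟩ ?_
    rintro _ ⟨t, ht, rfl⟩
    exact (hle t ht).trans (by linarith [hconv t ht])
  refine (hmB T hTmem).trans ?_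
  rw [le_div_iff₀ (by linarith)]
  linarith

namespace IsRenewalFunction

lemma one_le (h : IsRenewalFunction φ M) {t : ℝ} (ht : 0 ≤ t) : 1 ≤ M t := by
  have hzero : M 0 = 1 := by simpa using h.renewal 0 le_rfl
  exact hzero ▸ h.monotoneOn self_mem_Ici ht ht

lemma laplaceDefect_pos (h : IsRenewalFunction φ M) (hs : 0 < s) : 0 < laplaceDefect φ s :=
  CriticalLocalTime.laplaceDefect_pos h.density_nonneg h.density_integrable
    (h.density_integral ▸ one_pos) hs

lemma laplaceTransform_density (h : IsRenewalFunction φ M) (hs : 0 ≤ s) :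
    laplaceTransform φ s = 1 - laplaceDefect φ s := by
  rw [laplaceTransform_eq_integral_sub_laplaceDefect h.density_integrable hs, h.density_integral]

lemma exp_neg_mul_mul_eq (h : IsRenewalFunction φ M) {t : ℝ} (ht : 0 ≤ t) :
    Real.exp (-(s * t)) * M t = Real.exp (-(s * t)) + ∫ u in (0 : ℝ)..t,
      Real.exp (-(s * u)) * φ u * (Real.exp (-(s * (t - u))) * M (t - u)) := by
  rw [h.renewal t ht, mul_add, mul_one, ← intervalIntegral.integral_const_mul]
  congr 1
  refine intervalIntegral.integral_congr fun u _ => ?_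
  have hexp : Real.exp (-(s * t)) = Real.exp (-(s * u)) * Real.exp (-(s * (t - u))) := by
    rw [← Real.exp_add]
    ring_nf
  simp only [hexp]
  ring

lemma exp_neg_mul_mul_le (h : IsRenewalFunction φ M) (hs : 0 < s) {t : ℝ} (ht : 0 ≤ t) :
    Real.exp (-(s * t)) * M t ≤ 1 / laplaceDefect φ s := by
  have hM : ∀ u ≥ 0, 0 ≤ M u := fun u hu => zero_le_one.trans (h.one_le hu)
  have hexp : ∀ u ≥ 0, Real.exp (-(s * u)) ≤ 1 := fun u hu => by
    rw [Real.exp_le_one_iff, neg_nonpos]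
    exact mul_nonneg hs.le hu
  have hlaplace := h.laplaceTransform_density hs.le
  rw [laplaceTransform] at hlaplace
  rw [← sub_sub_cancel 1 (laplaceDefect φ s), ← hlaplace]
  refine le_div_of_le_add_integral (m := fun u => Real.exp (-(s * u)) * M u)
    (fun u hu => mul_nonneg (Real.exp_pos _).le (h.density_nonneg u hu))
    (CriticalLocalTime.integrableOn_exp_neg_mul_mul h.density_integrable hs.le)
    (by linarith [h.laplaceDefect_pos hs]) ht
    (fun u hu => mul_nonneg (Real.exp_pos _).le (hM u hu.1)) ⟨M t, ?_⟩ fun u hu => ?_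
  · rintro _ ⟨u, hu, rfl⟩
    exact (mul_le_of_le_one_left (hM u hu.1) (hexp u hu.1)).trans (h.monotoneOn hu.1 ht hu.2)
  · rw [h.exp_neg_mul_mul_eq hu.1]
    gcongr
    exact hexp u hu.1

lemma integrableOn_exp_neg_mul_mul (h : IsRenewalFunction φ M) (hs : 0 < s) :
    IntegrableOn (fun t => Real.exp (-(s * t)) * M t) (Ioi 0) := by
  refine Integrable.mono' ((exp_neg_integrableOn_Ioi 0 (half_pos hs)).const_mul
    (1 / laplaceDefect φ (s / 2))) ?_ ?_
  · exact (by fun_prop : Measurable fun t : ℝ => Real.exp (-(s * t))).aestronglyMeasurable.mul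
      (aemeasurable_restrict_of_monotoneOn measurableSet_Ioi
        (h.monotoneOn.mono Ioi_subset_Ici_self)).aestronglyMeasurable
  · filter_upwards [ae_restrict_mem measurableSet_Ioi] with t ht
    rw [Real.norm_of_nonneg (mul_nonneg (Real.exp_pos _).le
        (zero_le_one.trans (h.one_le (le_of_lt ht)))),
      show -(s * t) = -(s / 2) * t + -(s / 2 * t) by ring, Real.exp_add, mul_assoc, mul_comm]
    exact mul_le_mul_of_nonneg_right (h.exp_neg_mul_mul_le (half_pos hs) (le_of_lt ht))
      (Real.exp_pos _).le

theorem mul_laplaceTransform_eq (h : IsRenewalFunction φ M) (hs : 0 < s) :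
    s * laplaceTransform M s = 1 / laplaceDefect φ s := by
  have hM := h.integrableOn_exp_neg_mul_mul hs
  have hconst : IntegrableOn (fun t => Real.exp (-(s * t))) (Ioi 0) := by
    simpa only [neg_mul] using exp_neg_integrableOn_Ioi 0 hs
  have hconv : ∫ t in Ioi (0 : ℝ), (∫ u in (0 : ℝ)..t, Real.exp (-(s * u)) * φ u *
      (Real.exp (-(s * (t - u))) * M (t - u))) = laplaceTransform φ s * laplaceTransform M s :=
    integral_posConvolution
      (CriticalLocalTime.integrableOn_exp_neg_mul_mul h.density_integrable hs.le) hM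
      (ContinuousLinearMap.mul ℝ ℝ)
  have hlaplace : laplaceTransform φ s * laplaceTransform M s = laplaceTransform M s - s⁻¹ := by
    rw [← hconv, ← laplaceTransform_one hs]
    simp only [laplaceTransform, mul_one]
    rw [← integral_sub hM hconst]
    refine setIntegral_congr_fun measurableSet_Ioi fun t ht => ?_
    exact eq_sub_of_add_eq' (h.exp_neg_mul_mul_eq (le_of_lt ht)).symm
  rw [h.laplaceTransform_density hs.le] at hlaplace
  rw [eq_div_iff (h.laplaceDefect_pos hs).ne']
  linear_combination -s * hlaplace + mul_inv_cancel₀ hs.ne'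

end IsRenewalFunction

end Renewal

section Tauberian

section Moments

variable {α ι : Type*} [MeasurableSpace α] {μ : Measure α} {y : α → ℝ} {a b : ℝ} {h : ℝ → ℝ}
  {F : ι → α → ℝ} {G : α → ℝ} {l : Filter ι}

lemma integrable_comp_mul_of_mem_Icc (hy : Measurable y) (hyI : ∀ᵐ x ∂μ, y x ∈ Icc a b)
    (hG : Integrable G μ) (hh : Continuous h) : Integrable (fun x => h (y x) * G x) μ := by
  obtain ⟨C, hC⟩ := isCompact_Icc.exists_bound_of_continuousOn (s := Icc a b) hh.continuousOn
  refine hG.bdd_mul (c := C) (hh.measurable.comp hy).aestronglyMeasurable ?_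
  filter_upwards [hyI] with x hx using hC _ hx

lemma abs_integral_comp_mul_sub_le (hy : Measurable y) (hyI : ∀ᵐ x ∂μ, y x ∈ Icc a b)
    (hG : Integrable G μ) (hh : Continuous h) {q : ℝ → ℝ} (hq : Continuous q) {δ : ℝ}
    (hδ : ∀ v ∈ Icc a b, |h v - q v| ≤ δ) :
    |∫ x, h (y x) * G x ∂μ - ∫ x, q (y x) * G x ∂μ| ≤ δ * ∫ x, |G x| ∂μ := by
  rw [← integral_sub (integrable_comp_mul_of_mem_Icc hy hyI hG hh)
    (integrable_comp_mul_of_mem_Icc hy hyI hG hq), ← integral_const_mul, ← Real.norm_eq_abs]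
  refine norm_integral_le_of_norm_le (hG.abs.const_mul δ) ?_
  filter_upwards [hyI] with x hx
  rw [← sub_mul, Real.norm_eq_abs, abs_mul]
  exact mul_le_mul_of_nonneg_right (hδ _ hx) (abs_nonneg _)

lemma tendsto_integral_eval_mul (hy : Measurable y) (hyI : ∀ᵐ x ∂μ, y x ∈ Icc a b)
    (hF : ∀ᶠ s in l, Integrable (F s) μ) (hG : Integrable G μ)
    (hmom : ∀ k : ℕ, Tendsto (fun s => ∫ x, y x ^ k * F s x ∂μ) l (𝓝 (∫ x, y x ^ k * G x ∂μ)))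
    (q : Polynomial ℝ) :
    Tendsto (fun s => ∫ x, q.eval (y x) * F s x ∂μ) l (𝓝 (∫ x, q.eval (y x) * G x ∂μ)) := by
  induction q using Polynomial.induction_on' with
  | add q r hq hr =>
    have hsplit : ∀ {G : α → ℝ}, Integrable G μ → ∫ x, (q + r).eval (y x) * G x ∂μ =
        ∫ x, q.eval (y x) * G x ∂μ + ∫ x, r.eval (y x) * G x ∂μ := fun hG => by
      simp only [Polynomial.eval_add, add_mul]
      exact integral_add (integrable_comp_mul_of_mem_Icc hy hyI hG q.continuous)
        (integrable_comp_mul_of_mem_Icc hy hyI hG r.continuous)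
    rw [hsplit hG]
    exact (hq.add hr).congr' (hF.mono fun s hs => (hsplit hs).symm)
  | monomial k c =>
    simpa only [Polynomial.eval_monomial, mul_assoc, integral_const_mul] using
      (hmom k).const_mul c

theorem tendsto_integral_comp_mul_of_tendsto_moments (hy : Measurable y)
    (hyI : ∀ᵐ x ∂μ, y x ∈ Icc a b) (hFnonneg : ∀ᶠ s in l, 0 ≤ᵐ[μ] F s)
    (hF : ∀ᶠ s in l, Integrable (F s) μ) (hG : Integrable G μ)
    (hmom : ∀ k : ℕ, Tendsto (fun s => ∫ x, y x ^ k * F s x ∂μ) l (𝓝 (∫ x, y x ^ k * G x ∂μ)))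
    (hh : Continuous h) :
    Tendsto (fun s => ∫ x, h (y x) * F s x ∂μ) l (𝓝 (∫ x, h (y x) * G x ∂μ)) := by
  set C := ∫ x, |G x| ∂μ
  have hC : 0 ≤ C := integral_nonneg fun x => abs_nonneg _
  have hmass : ∀ᶠ s in l, ∫ x, |F s x| ∂μ < C + 1 := by
    have hlim : Tendsto (fun s => ∫ x, F s x ∂μ) l (𝓝 (∫ x, G x ∂μ)) := by
      simpa only [pow_zero, one_mul] using hmom 0
    have hle : ∫ x, G x ∂μ ≤ C := integral_mono hG hG.abs fun x => le_abs_self _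
    filter_upwards [hFnonneg, hlim.eventually_lt_const (hle.trans_lt (lt_add_one C))] with s hnn hs
    refine (integral_congr_ae ?_).trans_lt hs
    filter_upwards [hnn] with x hx using abs_of_nonneg hx
  refine Metric.tendsto_nhds.2 fun ε hε => ?_
  set δ := ε / (3 * (C + 1))
  have hδ : δ * (C + 1) = ε / 3 := by simp only [δ]; field_simp
  have hδ0 : 0 < δ := by positivity
  obtain ⟨q, hq⟩ := exists_polynomial_near_of_continuousOn a b h hh.continuousOn δ hδ0
  have hqh : ∀ v ∈ Icc a b, |h v - q.eval v| ≤ δ := fun v hv => by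
    rw [abs_sub_comm]
    exact (hq v hv).le
  filter_upwards [hF, hmass, Metric.tendsto_nhds.1 (tendsto_integral_eval_mul hy hyI hF hG hmom q)
    (ε / 3) (by positivity)] with s hFs hs hqs
  have happroxF := abs_integral_comp_mul_sub_le hy hyI hFs hh q.continuous hqh
  have happroxG := abs_integral_comp_mul_sub_le hy hyI hG hh q.continuous hqh
  rw [Real.dist_eq, abs_lt] at hqs ⊢
  rw [abs_le] at happroxF happroxG
  have := mul_lt_mul_of_pos_left hs hδ0
  constructor <;> nlinarith

end Moments

section LaplaceContinuity

/-- The integral of `f` over `(0, ∞)` against a bump supported in `[a, b]`. The bump has the form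
`e⁻ˣ h(e⁻ˣ)` with `h` continuous on `[0, 1]`, so that by Weierstrass' theorem the Laplace transform
of `f` at the positive integers controls the integral. -/
noncomputable def bumpIntegral (a b : ℝ) (f : ℝ → ℝ) : ℝ :=
  ∫ x in Ioi (0 : ℝ), max 0 ((Real.exp (-x) - Real.exp (-b)) * (Real.exp (-a) - Real.exp (-x))) *
    (Real.exp (-x) * f x)

variable {ι : Type*} {l : Filter ι} {F : ι → ℝ → ℝ} {f g : ℝ → ℝ} {a b c : ℝ}

lemma exp_neg_mem_Icc : ∀ᵐ x ∂volume.restrict (Ioi (0 : ℝ)), Real.exp (-x) ∈ Icc (0 : ℝ) 1 := by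
  filter_upwards [ae_restrict_mem measurableSet_Ioi] with x hx
  exact ⟨(Real.exp_pos _).le, Real.exp_le_one_iff.2 (neg_nonpos.2 (le_of_lt hx))⟩

lemma integrableOn_exp_neg_mul_const (c : ℝ) :
    IntegrableOn (fun x => Real.exp (-x) * c) (Ioi 0) :=
  (integrableOn_exp_neg_Ioi 0).mul_const c

lemma integrableOn_bump_mul (a b : ℝ) (hf : IntegrableOn (fun x => Real.exp (-x) * f x) (Ioi 0)) :
    IntegrableOn (fun x => max 0 ((Real.exp (-x) - Real.exp (-b)) *
      (Real.exp (-a) - Real.exp (-x))) * (Real.exp (-x) * f x)) (Ioi 0) :=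
  integrable_comp_mul_of_mem_Icc
    (h := fun v => max 0 ((v - Real.exp (-b)) * (Real.exp (-a) - v))) (by fun_prop)
    exp_neg_mem_Icc hf (by fun_prop)

lemma bumpIntegral_const (a b c : ℝ) :
    bumpIntegral a b (fun _ => c) = c * bumpIntegral a b fun _ => 1 := by
  rw [bumpIntegral, bumpIntegral, ← integral_const_mul]
  congr with x
  ring

lemma bumpIntegral_mono (hab : a ≤ b)
    (hf : IntegrableOn (fun x => Real.exp (-x) * f x) (Ioi 0))
    (hg : IntegrableOn (fun x => Real.exp (-x) * g x) (Ioi 0)) (hfg : ∀ x ∈ Icc a b, f x ≤ g x) :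
    bumpIntegral a b f ≤ bumpIntegral a b g := by
  refine integral_mono (integrableOn_bump_mul a b hf) (integrableOn_bump_mul a b hg) fun x => ?_
  rcases le_or_gt ((Real.exp (-x) - Real.exp (-b)) * (Real.exp (-a) - Real.exp (-x))) 0 with
    hle | hpos
  · simp only [max_eq_left hle, zero_mul, le_refl]
  · have hx : x ∈ Icc a b := by
      rcases pos_and_pos_or_neg_and_neg_of_mul_pos hpos with ⟨hb, ha⟩ | ⟨hb, ha⟩ <;>
        simp only [sub_pos, sub_neg, Real.exp_lt_exp, neg_lt_neg_iff] at ha hb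
      exacts [⟨ha.le, hb.le⟩, absurd (hb.trans ha) hab.not_gt]
    dsimp only
    gcongr
    exact hfg x hx

lemma bumpIntegral_one_pos (ha : 0 ≤ a) (hab : a < b) : 0 < bumpIntegral a b fun _ => 1 := by
  have hint := integrableOn_bump_mul a b (integrableOn_exp_neg_mul_const 1)
  refine (integral_pos_iff_support_of_nonneg (fun x => by positivity) hint).2 ?_
  refine lt_of_lt_of_le ?_ (measure_mono (show Ioo a b ⊆ _ from fun x hx => ?_))
  · rw [Measure.restrict_apply measurableSet_Ioo, inter_eq_left.2
      (Ioo_subset_Ioi_self.trans (Ioi_subset_Ioi ha)), Real.volume_Ioo]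
    simpa using hab
  · have hpos : 0 < (Real.exp (-x) - Real.exp (-b)) * (Real.exp (-a) - Real.exp (-x)) := by
      refine mul_pos ?_ ?_ <;> simp [hx.1, hx.2]
    exact (mul_pos (lt_max_of_lt_right hpos) (by positivity)).ne'

lemma bumpIntegral_const_lt (ha : 0 ≤ a) (hab : a < b) {c' : ℝ} (hc : c < c') :
    bumpIntegral a b (fun _ => c) < bumpIntegral a b fun _ => c' := by
  rw [bumpIntegral_const, bumpIntegral_const a b c']
  exact mul_lt_mul_of_pos_right hc (bumpIntegral_one_pos ha hab)

lemma tendsto_bumpIntegral (a b : ℝ) (hFnonneg : ∀ᶠ s in l, ∀ x > 0, 0 ≤ F s x)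
    (hF : ∀ᶠ s in l, IntegrableOn (fun x => Real.exp (-x) * F s x) (Ioi 0))
    (hg : IntegrableOn (fun x => Real.exp (-x) * g x) (Ioi 0))
    (hlim : ∀ k : ℕ, Tendsto (fun s => laplaceTransform (F s) (k + 1)) l
      (𝓝 (laplaceTransform g (k + 1)))) :
    Tendsto (fun s => bumpIntegral a b (F s)) l (𝓝 (bumpIntegral a b g)) := by
  refine tendsto_integral_comp_mul_of_tendsto_moments (y := fun x => Real.exp (-x))
    (h := fun v => max 0 ((v - Real.exp (-b)) * (Real.exp (-a) - v))) (by fun_prop)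
    exp_neg_mem_Icc (hFnonneg.mono fun s hs => ?_) hF hg (fun k => ?_) (by fun_prop)
  · filter_upwards [ae_restrict_mem measurableSet_Ioi] with x hx
    exact mul_nonneg (Real.exp_pos _).le (hs x hx)
  · have hmoment : ∀ f : ℝ → ℝ, ∫ x in Ioi (0 : ℝ), Real.exp (-x) ^ k * (Real.exp (-x) * f x) =
        laplaceTransform f (k + 1) := fun f => by
      refine integral_congr_ae (.of_forall fun x => ?_)
      dsimp only
      rw [← mul_assoc, ← Real.exp_nat_mul, ← Real.exp_add]
      ring_nf
    simpa only [hmoment] using hlim k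

/-- By monotonicity, bumps supported just to the left and just to the right of `u` bound `F s u`
from below and from above. -/
theorem tendsto_of_tendsto_laplaceTransform (hFnonneg : ∀ᶠ s in l, ∀ x > 0, 0 ≤ F s x)
    (hFmono : ∀ᶠ s in l, MonotoneOn (F s) (Ioi 0))
    (hF : ∀ᶠ s in l, IntegrableOn (fun x => Real.exp (-x) * F s x) (Ioi 0))
    (hg : IntegrableOn (fun x => Real.exp (-x) * g x) (Ioi 0))
    (hlim : ∀ k : ℕ, Tendsto (fun s => laplaceTransform (F s) (k + 1)) l
      (𝓝 (laplaceTransform g (k + 1)))) {u : ℝ} (hu : 0 < u) (hgu : ContinuousAt g u) :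
    Tendsto (fun s => F s u) l (𝓝 (g u)) := by
  have hbump := fun a b => tendsto_bumpIntegral a b hFnonneg hF hg hlim
  have hconst := integrableOn_exp_neg_mul_const
  refine tendsto_order.2 ⟨fun c hc => ?_, fun c hc => ?_⟩
  · obtain ⟨c', hcc', hc'⟩ := exists_between hc
    obtain ⟨ε, hε, hball⟩ := Metric.nhds_basis_closedBall.eventually_iff.1
      ((hgu.eventually_const_lt hc').and (eventually_gt_nhds hu))
    rw [Real.closedBall_eq_Icc] at hball
    set a := u - ε
    have hau : a < u := sub_lt_self u hε
    have hIcc : ∀ x ∈ Icc a u, c' < g x ∧ 0 < x := fun x hx =>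
      hball ⟨hx.1, hx.2.trans (le_add_of_nonneg_right hε.le)⟩
    have ha : 0 < a := (hIcc a (left_mem_Icc.2 hau.le)).2
    have hlt : bumpIntegral a u (fun _ => c) < bumpIntegral a u g :=
      (bumpIntegral_const_lt ha.le hau hcc').trans_le
        (bumpIntegral_mono hau.le (hconst c') hg fun x hx => (hIcc x hx).1.le)
    filter_upwards [hF, hFmono, (hbump a u).eventually_const_lt hlt] with s hs hmono hcs
    by_contra! hle
    refine hcs.not_ge (bumpIntegral_mono hau.le hs (hconst c) fun x hx => ?_)
    exact (hmono (ha.trans_le hx.1) hu hx.2).trans hle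
  · obtain ⟨c', hc', hcc'⟩ := exists_between hc
    obtain ⟨ε, hε, hball⟩ := Metric.nhds_basis_closedBall.eventually_iff.1
      (hgu.eventually_lt_const hc')
    rw [Real.closedBall_eq_Icc] at hball
    set b := u + ε
    have hub : u < b := lt_add_of_pos_right u hε
    have hlt : bumpIntegral u b g < bumpIntegral u b fun _ => c :=
      (bumpIntegral_mono hub.le hg (hconst c') fun x hx =>
        (hball ⟨(sub_le_self u hε.le).trans hx.1, hx.2⟩).le).trans_lt
        (bumpIntegral_const_lt hu.le hub hcc')
    filter_upwards [hF, hFmono, (hbump u b).eventually_lt_const hlt] with s hs hmono hcs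
    by_contra! hle
    refine hcs.not_ge (bumpIntegral_mono hub.le (hconst c) hs fun x hx => ?_)
    exact hle.trans (hmono hu (hu.trans_le hx.1) hx.1)

end LaplaceContinuity
section RegularVariation

/-- Regular variation at `0+` in Karamata's sense: `A (c s) / A s → c ^ ρ` as `s → 0+`, for every
`c > 0`. In particular `A` does not vanish near `0`, as `x / 0 = 0`. -/
def IsRegularlyVaryingAtZero (A : ℝ → ℝ) (ρ : ℝ) : Prop :=
  ∀ c > 0, Tendsto (fun s => A (c * s) / A s) (𝓝[>] 0) (𝓝 (c ^ ρ))

lemma tendsto_const_mul_nhdsGT_zero {c : ℝ} (hc : 0 < c) :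
    Tendsto (fun s : ℝ => c * s) (𝓝[>] 0) (𝓝[>] 0) := by
  refine tendsto_nhdsWithin_iff.2 ⟨?_, ?_⟩
  · exact ((continuous_const_mul c).tendsto' 0 0 (mul_zero c)).mono_left nhdsWithin_le_nhds
  · filter_upwards [self_mem_nhdsWithin] with s hs using mul_pos hc hs

namespace IsRegularlyVaryingAtZero

variable {A B : ℝ → ℝ} {ρ σ : ℝ}

lemma eventually_ne_zero (hA : IsRegularlyVaryingAtZero A ρ) : ∀ᶠ s in 𝓝[>] 0, A s ≠ 0 := by
  filter_upwards [(hA 1 one_pos).eventually_ne (Real.rpow_pos_of_pos one_pos ρ).ne'] with s hs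
  exact (div_ne_zero_iff.1 hs).2

lemma congr_isEquivalent (hA : IsRegularlyVaryingAtZero A ρ) (hAB : A ~[𝓝[>] 0] B) :
    IsRegularlyVaryingAtZero B ρ := fun c hc =>
  ((hAB.comp_tendsto (tendsto_const_mul_nhdsGT_zero hc)).div hAB).tendsto_nhds (hA c hc)

lemma inv (hA : IsRegularlyVaryingAtZero A ρ) :
    IsRegularlyVaryingAtZero (fun s => (A s)⁻¹) (-ρ) := fun c hc => by
  simpa only [Real.rpow_neg hc.le, inv_div, inv_div_inv] using
    (hA c hc).inv₀ (Real.rpow_pos_of_pos hc ρ).ne'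

lemma mul (hA : IsRegularlyVaryingAtZero A ρ) (hB : IsRegularlyVaryingAtZero B σ) :
    IsRegularlyVaryingAtZero (fun s => A s * B s) (ρ + σ) := fun c hc => by
  simpa only [Real.rpow_add hc, mul_div_mul_comm] using (hA c hc).mul (hB c hc)

lemma const {C : ℝ} (hC : C ≠ 0) : IsRegularlyVaryingAtZero (fun _ => C) 0 := fun c _ => by
  simpa only [div_self hC, Real.rpow_zero] using tendsto_const_nhds

lemma const_mul (hA : IsRegularlyVaryingAtZero A ρ) {C : ℝ} (hC : C ≠ 0) :
    IsRegularlyVaryingAtZero (fun s => C * A s) ρ := by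
  simpa only [zero_add] using (const hC).mul hA

lemma rpow (ρ : ℝ) : IsRegularlyVaryingAtZero (fun s => s ^ ρ) ρ := fun c hc => by
  refine tendsto_const_nhds.congr' ?_
  filter_upwards [self_mem_nhdsWithin] with s hs
  rw [Real.mul_rpow hc.le (le_of_lt hs), mul_div_cancel_right₀ _ (Real.rpow_pos_of_pos hs ρ).ne']

lemma self : IsRegularlyVaryingAtZero (fun s => s) 1 := by
  simpa only [Real.rpow_one] using rpow 1

lemma neg_log : IsRegularlyVaryingAtZero (fun s => -Real.log s) 0 := fun c hc => by
  have hlog : Tendsto (fun s => Real.log c / Real.log s + 1) (𝓝[>] 0) (𝓝 1) := by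
    simpa using (Real.tendsto_log_nhdsGT_zero.const_div_atBot (Real.log c)).add_const 1
  rw [Real.rpow_zero]
  refine hlog.congr' ?_
  filter_upwards [Ioo_mem_nhdsGT one_pos] with s hs
  rw [neg_div_neg_eq, Real.log_mul hc.ne' hs.1.ne', add_div,
    div_self (Real.log_neg hs.1 hs.2).ne]

end IsRegularlyVaryingAtZero

end RegularVariation

section Karamata

variable {M : ℝ → ℝ} {ρ : ℝ}

lemma laplaceTransform_comp_div (f : ℝ → ℝ) (k : ℝ) {s : ℝ} (hs : 0 < s) :
    laplaceTransform (fun u => f (u / s)) k = s * laplaceTransform f (k * s) := by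
  have hscale := integral_comp_mul_right_Ioi (fun t => Real.exp (-(k * s * t)) * f t) 0
    (inv_pos.2 hs)
  rw [zero_mul, inv_inv, smul_eq_mul] at hscale
  rw [laplaceTransform, laplaceTransform, ← hscale]
  refine integral_congr_ae (.of_forall fun u => ?_)
  dsimp only
  rw [div_eq_mul_inv, mul_assoc k, mul_comm u, mul_inv_cancel_left₀ hs.ne']

lemma laplaceTransform_const_mul (f : ℝ → ℝ) (C k : ℝ) :
    laplaceTransform (fun u => C * f u) k = C * laplaceTransform f k := by
  simp only [laplaceTransform, mul_left_comm _ C, integral_const_mul]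

lemma laplaceTransform_div (f : ℝ → ℝ) (C k : ℝ) :
    laplaceTransform (fun u => f u / C) k = laplaceTransform f k / C := by
  simp only [div_eq_inv_mul, laplaceTransform_const_mul]

lemma laplaceTransform_rpow (hρ : -1 < ρ) {k : ℝ} (hk : 0 < k) :
    laplaceTransform (fun u => u ^ ρ) k = k ^ (-ρ) / k * Real.Gamma (ρ + 1) := by
  have hint := Real.integral_rpow_mul_exp_neg_mul_Ioi (a := ρ + 1) (by linarith) hk
  rw [add_sub_cancel_right] at hint
  simp only [laplaceTransform, mul_comm (Real.exp _)]
  rw [hint, one_div, Real.inv_rpow hk.le, Real.rpow_add_one hk.ne', Real.rpow_neg hk.le, mul_inv,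
    div_eq_mul_inv]

lemma integrableOn_of_laplaceTransform_ne_zero {f : ℝ → ℝ} {s : ℝ} (h : laplaceTransform f s ≠ 0) :
    IntegrableOn (fun x => Real.exp (-(s * x)) * f x) (Ioi 0) :=
  not_imp_comm.1 integral_undef h

lemma tendsto_laplaceTransform_comp_div_div (hρ : -1 < ρ)
    (hrv : IsRegularlyVaryingAtZero (fun s => s * laplaceTransform M s) (-ρ)) {k : ℝ}
    (hk : 0 < k) :
    Tendsto (fun s => laplaceTransform (fun u => M (u / s) / (s * laplaceTransform M s)) k)
      (𝓝[>] 0) (𝓝 (laplaceTransform (fun u => u ^ ρ / Real.Gamma (ρ + 1)) k)) := by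
  rw [laplaceTransform_div, laplaceTransform_rpow hρ hk,
    mul_div_cancel_right₀ _ (Real.Gamma_pos_of_pos (by linarith)).ne']
  refine ((hrv k hk).div_const k).congr' ?_
  filter_upwards [self_mem_nhdsWithin] with s hs
  rw [laplaceTransform_div, laplaceTransform_comp_div M k hs]
  field_simp

lemma tendsto_comp_inv_div_mul_laplaceTransform (hM : MonotoneOn M (Ioi 0))
    (hMnonneg : ∀ t > 0, 0 ≤ M t) (hρ : -1 < ρ)
    (hrv : IsRegularlyVaryingAtZero (fun s => s * laplaceTransform M s) (-ρ)) :
    Tendsto (fun s => M s⁻¹ / (s * laplaceTransform M s)) (𝓝[>] 0)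
      (𝓝 (Real.Gamma (ρ + 1))⁻¹) := by
  have hden : ∀ s > 0, 0 ≤ s * laplaceTransform M s := fun s hs => mul_nonneg hs.le
    (setIntegral_nonneg measurableSet_Ioi fun t ht =>
      mul_nonneg (Real.exp_pos _).le (hMnonneg t ht))
  have hintegrable : ∀ f : ℝ → ℝ, laplaceTransform f 1 ≠ 0 →
      IntegrableOn (fun x => Real.exp (-x) * f x) (Ioi 0) := fun f hf => by
    simpa only [one_mul] using integrableOn_of_laplaceTransform_ne_zero hf
  have hlimit_ne : laplaceTransform (fun u => u ^ ρ / Real.Gamma (ρ + 1)) 1 ≠ 0 := by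
    rw [laplaceTransform_div, laplaceTransform_rpow hρ one_pos]
    simp [(Real.Gamma_pos_of_pos (by linarith : 0 < ρ + 1)).ne']
  have hscaled_ne :=
    (tendsto_laplaceTransform_comp_div_div hρ hrv one_pos).eventually_ne hlimit_ne
  simpa only [Real.one_rpow, one_div] using tendsto_of_tendsto_laplaceTransform
    (l := 𝓝[>] 0) (F := fun s u => M (u / s) / (s * laplaceTransform M s))
    (eventually_mem_nhdsWithin.mono fun s hs x hx =>
      div_nonneg (hMnonneg _ (div_pos hx hs)) (hden s hs))
    (eventually_mem_nhdsWithin.mono fun s hs x hx y hy hxy =>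
      div_le_div_of_nonneg_right (hM (mem_Ioi.2 (div_pos hx hs)) (mem_Ioi.2 (div_pos hy hs))
        (div_le_div_of_nonneg_right hxy (le_of_lt hs))) (hden s hs))
    (hscaled_ne.mono fun s hs => hintegrable _ hs) (hintegrable _ hlimit_ne)
    (fun k => tendsto_laplaceTransform_comp_div_div hρ hrv k.cast_add_one_pos) one_pos
    ((Real.continuousAt_rpow_const 1 ρ (.inl one_ne_zero)).div_const _)

theorem isEquivalent_of_isRegularlyVaryingAtZero (hM : MonotoneOn M (Ioi 0))
    (hMnonneg : ∀ t > 0, 0 ≤ M t) (hρ : -1 < ρ)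
    (hrv : IsRegularlyVaryingAtZero (fun s => s * laplaceTransform M s) (-ρ)) :
    (fun s => M s⁻¹) ~[𝓝[>] 0] fun s => (Real.Gamma (ρ + 1))⁻¹ * (s * laplaceTransform M s) := by
  have hlim := tendsto_comp_inv_div_mul_laplaceTransform hM hMnonneg hρ hrv
  rw [← isEquivalent_const_iff_tendsto
    (inv_pos.2 (Real.Gamma_pos_of_pos (by linarith))).ne'] at hlim
  refine (hlim.mul (IsEquivalent.refl (u := fun s => s * laplaceTransform M s))).congr_left ?_
  filter_upwards [hrv.eventually_ne_zero] with s hs using div_mul_cancel₀ _ hs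

theorem IsRenewalFunction.isEquivalent_atTop {φ g : ℝ → ℝ} (h : IsRenewalFunction φ M)
    (hρ : -1 < ρ) (hφ : laplaceDefect φ ~[𝓝[>] 0] g) (hg : IsRegularlyVaryingAtZero g ρ) :
    M ~[atTop] fun t => (Real.Gamma (ρ + 1) * g t⁻¹)⁻¹ := by
  have hB : (fun s => s * laplaceTransform M s) ~[𝓝[>] 0] fun s => (g s)⁻¹ := by
    refine hφ.inv.congr_left ?_
    filter_upwards [self_mem_nhdsWithin] with s hs
    rw [h.mul_laplaceTransform_eq hs, one_div, Pi.inv_apply]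
  have hkaramata := isEquivalent_of_isRegularlyVaryingAtZero
    (h.monotoneOn.mono Ioi_subset_Ici_self)
    (fun t ht => zero_le_one.trans (h.one_le (le_of_lt ht))) hρ (hg.inv.congr_isEquivalent hB.symm)
  have := (hkaramata.trans ((IsEquivalent.refl (u := fun _ => (Real.Gamma (ρ + 1))⁻¹)).mul
    hB)).comp_tendsto tendsto_inv_atTop_nhdsGT_zero
  simpa only [Function.comp_def, inv_inv, Pi.mul_apply, mul_inv] using this

end Karamata

end Tauberian

section Abelian

variable {f g : ℝ → ℝ} {s c α : ℝ}

/-- The tail `t ↦ ∫_t^∞ f` of a function integrable at infinity. -/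
noncomputable def tailIntegral (f : ℝ → ℝ) (t : ℝ) : ℝ :=
  ∫ u in Ioi t, f u

lemma integral_exp_neg_mul (hs : s ≠ 0) (u : ℝ) :
    ∫ v in (0 : ℝ)..u, Real.exp (-(s * v)) = (1 - Real.exp (-(s * u))) / s := by
  simp only [← neg_mul]
  rw [intervalIntegral.integral_comp_mul_left Real.exp (neg_ne_zero.2 hs), integral_exp,
    mul_zero, Real.exp_zero, smul_eq_mul, inv_neg, div_eq_inv_mul]
  ring

/-- Integration by parts, in the form of Fubini's theorem for `s e^{-sv} f(u)` on `0 < v < u`. -/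
theorem laplaceDefect_eq_mul_laplaceTransform_tailIntegral (hf : IntegrableOn f (Ioi 0))
    (hs : 0 < s) : laplaceDefect f s = s * laplaceTransform (tailIntegral f) s := by
  have hexp : IntegrableOn (fun v => s * Real.exp (-(s * v))) (Ioi 0) := by
    simp only [← neg_mul]
    exact (exp_neg_integrableOn_Ioi 0 hs).const_mul s
  have hprod : Integrable (Function.uncurry fun u v => (Iio u).indicator
      (fun v => f u * (s * Real.exp (-(s * v)))) v)
      ((volume.restrict (Ioi 0)).prod (volume.restrict (Ioi 0))) := by
    refine ((Integrable.mul_prod hf hexp).indicator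
      (measurableSet_lt measurable_snd measurable_fst)).congr (.of_forall fun z => ?_)
    simp only [indicator, Function.uncurry, mem_Iio, mem_ofPred_eq]
  have hleft : ∀ u ∈ Ioi (0 : ℝ), ∫ v in Ioi (0 : ℝ), (Iio u).indicator
      (fun v => f u * (s * Real.exp (-(s * v)))) v = (1 - Real.exp (-(s * u))) * f u :=
    fun u hu => by
      rw [setIntegral_indicator measurableSet_Iio, Ioi_inter_Iio, integral_const_mul,
        ← integral_Ioc_eq_integral_Ioo, ← intervalIntegral.integral_of_le (le_of_lt hu),
        intervalIntegral.integral_const_mul, integral_exp_neg_mul hs.ne', mul_div_cancel₀ _ hs.ne',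
        mul_comm]
  have hright : ∀ v ∈ Ioi (0 : ℝ), ∫ u in Ioi (0 : ℝ), (Iio u).indicator
      (fun v => f u * (s * Real.exp (-(s * v)))) v =
        s * (Real.exp (-(s * v)) * tailIntegral f v) := fun v hv => by
    have hswap : ∀ u, (Iio u).indicator (fun v => f u * (s * Real.exp (-(s * v)))) v =
        (Ioi v).indicator (fun u => f u * (s * Real.exp (-(s * v)))) u := fun u => by
      simp only [indicator, mem_Iio, mem_Ioi]
    simp only [hswap]
    rw [setIntegral_indicator measurableSet_Ioi,
      inter_eq_self_of_subset_right (Ioi_subset_Ioi (le_of_lt hv)), integral_mul_const,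
      tailIntegral]
    ring
  rw [laplaceDefect, laplaceTransform, ← integral_const_mul,
    ← setIntegral_congr_fun measurableSet_Ioi hleft,
    ← setIntegral_congr_fun measurableSet_Ioi hright]
  exact integral_integral_swap hprod

lemma isLittleO_tailIntegral {T : ℝ} (hg : ∀ t > T, 0 ≤ g t) (hint : IntegrableOn g (Ioi T))
    (hfg : f =o[atTop] g) : tailIntegral f =o[atTop] tailIntegral g := by
  refine isLittleO_iff.2 fun ε hε => ?_
  obtain ⟨N, hN⟩ := eventually_atTop.1 (isLittleO_iff.1 hfg hε)
  filter_upwards [eventually_ge_atTop N, eventually_ge_atTop T] with t htN htT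
  have hnonneg : ∀ u ∈ Ioi t, 0 ≤ g u := fun u hu => hg u (htT.trans_lt hu)
  unfold tailIntegral
  rw [Real.norm_of_nonneg (setIntegral_nonneg measurableSet_Ioi hnonneg), ← integral_const_mul]
  refine norm_integral_le_of_norm_le ((hint.mono_set (Ioi_subset_Ioi htT)).const_mul ε) ?_
  filter_upwards [ae_restrict_mem measurableSet_Ioi] with u hu
  simpa only [Real.norm_of_nonneg (hnonneg u hu)] using hN u (htN.trans (le_of_lt hu))

lemma tailIntegral_rpow (hα : 1 < α) {t : ℝ} (ht : 0 < t) :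
    tailIntegral (fun u => u ^ (-α)) t = t ^ (1 - α) / (α - 1) := by
  rw [tailIntegral, integral_Ioi_rpow_of_lt (by linarith) ht, neg_div, ← div_neg]
  ring_nf

lemma isEquivalent_tailIntegral (hint : IntegrableOn f (Ioi 0)) (hc : c ≠ 0) (hα : 1 < α)
    (hf : f ~[atTop] fun t => c * t ^ (-α)) :
    tailIntegral f ~[atTop] fun t => c / (α - 1) * t ^ (1 - α) := by
  have hpow : IntegrableOn (fun t : ℝ => t ^ (-α)) (Ioi 1) :=
    integrableOn_Ioi_rpow_of_lt (by linarith) one_pos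
  have hlittle := isLittleO_tailIntegral (f := fun t => f t - c * t ^ (-α))
    (fun t ht => Real.rpow_nonneg (zero_le_one.trans (le_of_lt ht)) _) hpow
    (hf.isLittleO.trans_isBigO (isBigO_const_mul_self c _ _))
  have htail : ∀ t > 0, c * tailIntegral (fun t => t ^ (-α)) t = c / (α - 1) * t ^ (1 - α) :=
    fun t ht => by rw [tailIntegral_rpow hα ht, mul_div_assoc', mul_div_right_comm]
  refine ((isLittleO_const_mul_right_iff hc).2 hlittle).congr' ?_ ?_
  · filter_upwards [eventually_ge_atTop 1] with t ht
    have hsub : Ioi t ⊆ Ioi 1 := Ioi_subset_Ioi ht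
    rw [Pi.sub_apply, ← htail t (zero_lt_one.trans_le ht), tailIntegral, tailIntegral, tailIntegral,
      ← integral_const_mul, integral_sub (hint.mono_set (Ioi_subset_Ioi (zero_le_one.trans ht)))
      ((hpow.mono_set hsub).const_mul c)]
  · filter_upwards [eventually_gt_atTop 0] with t ht using htail t ht

lemma isLittleO_laplaceTransform {s₀ : ℝ} (hs₀ : 0 ≤ s₀)
    (hf : IntegrableOn (fun t => Real.exp (-(s₀ * t)) * f t) (Ioi 0)) (hg : ∀ t > 0, 0 ≤ g t)
    (hfg : f =o[atTop] g) (hlim : Tendsto (laplaceTransform g) (𝓝[>] 0) atTop) :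
    laplaceTransform f =o[𝓝[>] 0] laplaceTransform g := by
  refine isLittleO_iff.2 fun ε hε => ?_
  obtain ⟨T, hT⟩ := eventually_atTop.1 (isLittleO_iff.1 hfg (half_pos hε))
  set K := ∫ t in Ioi 0, Real.exp (s₀ * T) * ‖Real.exp (-(s₀ * t)) * f t‖
  filter_upwards [hlim.eventually_gt_atTop 0, hlim.eventually_ge_atTop (K / (ε / 2)),
    self_mem_nhdsWithin] with s hpos hK hs
  have hgs := integrableOn_of_laplaceTransform_ne_zero hpos.ne'
  have hbound : ‖laplaceTransform f s‖ ≤ K + ε / 2 * laplaceTransform g s := by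
    rw [laplaceTransform, laplaceTransform, ← integral_const_mul,
      ← integral_add (hf.norm.const_mul _) (hgs.const_mul _)]
    refine norm_integral_le_of_norm_le ((hf.norm.const_mul _).add (hgs.const_mul _)) ?_
    filter_upwards [ae_restrict_mem measurableSet_Ioi] with t ht
    have hexp := Real.exp_pos (-(s * t))
    have hK_nonneg : 0 ≤ Real.exp (s₀ * T) * ‖Real.exp (-(s₀ * t)) * f t‖ := by positivity
    have hg_nonneg : 0 ≤ ε / 2 * (Real.exp (-(s * t)) * g t) := by
      have := hg t ht
      positivity
    rcases le_total t T with htT | htT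
    · refine le_add_of_le_of_nonneg ?_ hg_nonneg
      rw [norm_mul, norm_mul, ← mul_assoc]
      refine mul_le_mul_of_nonneg_right ?_ (norm_nonneg _)
      rw [Real.norm_of_nonneg hexp.le, Real.norm_of_nonneg (Real.exp_pos _).le, ← Real.exp_add,
        Real.exp_le_exp]
      nlinarith [mul_pos (mem_Ioi.1 hs) (mem_Ioi.1 ht), mul_le_mul_of_nonneg_left htT hs₀]
    · refine le_add_of_nonneg_of_le hK_nonneg ?_
      rw [norm_mul, Real.norm_of_nonneg hexp.le, mul_left_comm]
      refine mul_le_mul_of_nonneg_left ?_ hexp.le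
      simpa only [Real.norm_of_nonneg (hg t ht)] using hT t htT
  rw [div_le_iff₀' (half_pos hε)] at hK
  rw [Real.norm_of_nonneg hpos.le]
  linarith

lemma isEquivalent_laplaceTransform
    (hf : ∀ s > 0, IntegrableOn (fun t => Real.exp (-(s * t)) * f t) (Ioi 0))
    (hg : ∀ t > 0, 0 ≤ g t) (hfg : f ~[atTop] g)
    (hlim : Tendsto (laplaceTransform g) (𝓝[>] 0) atTop) :
    laplaceTransform f ~[𝓝[>] 0] laplaceTransform g := by
  have hsub : ∀ᶠ s in 𝓝[>] 0, 0 < s ∧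
      IntegrableOn (fun t => Real.exp (-(s * t)) * (f t - g t)) (Ioi 0) ∧
      laplaceTransform (f - g) s = laplaceTransform f s - laplaceTransform g s := by
    filter_upwards [hlim.eventually_ne_atTop 0, self_mem_nhdsWithin] with s hne hs
    have hgs := integrableOn_of_laplaceTransform_ne_zero hne
    simp only [laplaceTransform, Pi.sub_apply, mul_sub]
    exact ⟨hs, (hf s hs).sub hgs, integral_sub (hf s hs) hgs⟩
  obtain ⟨s₀, hs₀, hint, -⟩ := hsub.exists
  refine (isLittleO_laplaceTransform hs₀.le hint hg hfg.isLittleO hlim).congr' ?_ .rfl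
  filter_upwards [hsub] with s hs using hs.2.2

theorem isEquivalent_laplaceDefect (hf : ∀ t > 0, 0 ≤ f t) (hint : IntegrableOn f (Ioi 0))
    (hpos : 0 < ∫ t in Ioi (0 : ℝ), f t) (hg : ∀ t > 0, 0 ≤ g t) (hfg : tailIntegral f ~[atTop] g)
    (hlim : Tendsto (laplaceTransform g) (𝓝[>] 0) atTop) :
    laplaceDefect f ~[𝓝[>] 0] fun s => s * laplaceTransform g s := by
  have htail : ∀ s > 0, IntegrableOn (fun t => Real.exp (-(s * t)) * tailIntegral f t) (Ioi 0) :=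
    fun s hs => integrableOn_of_laplaceTransform_ne_zero fun hzero => by
      have := laplaceDefect_pos hf hint hpos hs
      simp [laplaceDefect_eq_mul_laplaceTransform_tailIntegral hint hs, hzero] at this
  refine ((IsEquivalent.refl (u := fun s : ℝ => s)).mul
    (isEquivalent_laplaceTransform htail hg hfg hlim)).congr_left ?_
  filter_upwards [self_mem_nhdsWithin] with s hs
  exact (laplaceDefect_eq_mul_laplaceTransform_tailIntegral hint hs).symm

theorem isEquivalent_laplaceDefect_rpow (hf : ∀ t > 0, 0 ≤ f t) (hint : IntegrableOn f (Ioi 0))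
    (hpos : 0 < ∫ t in Ioi (0 : ℝ), f t) (hc : 0 < c) (hα₁ : 1 < α) (hα₂ : α < 2)
    (hfα : f ~[atTop] fun t => c * t ^ (-α)) :
    laplaceDefect f ~[𝓝[>] 0] fun s => c / (α - 1) * Real.Gamma (2 - α) * s ^ (α - 1) := by
  have hΓ := Real.Gamma_pos_of_pos (sub_pos.2 hα₂)
  have hα : 0 < α - 1 := sub_pos.2 hα₁
  have htransform : ∀ s > 0, s * laplaceTransform (fun t => c / (α - 1) * t ^ (1 - α)) s =
      c / (α - 1) * Real.Gamma (2 - α) * s ^ (α - 1) := fun s hs => by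
    rw [laplaceTransform_const_mul, laplaceTransform_rpow (by linarith) hs, neg_sub,
      sub_add_eq_add_sub, one_add_one_eq_two]
    field_simp
  have hlim : Tendsto (laplaceTransform fun t => c / (α - 1) * t ^ (1 - α)) (𝓝[>] 0) atTop := by
    have hrpow : Tendsto (fun s : ℝ => s⁻¹ ^ (2 - α)) (𝓝[>] 0) atTop :=
      (tendsto_rpow_atTop (sub_pos.2 hα₂)).comp tendsto_inv_nhdsGT_zero
    refine (hrpow.const_mul_atTop (r := c / (α - 1) * Real.Gamma (2 - α)) (by positivity)).congr'
      ?_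
    filter_upwards [self_mem_nhdsWithin] with s hs
    refine mul_left_cancel₀ (ne_of_gt hs) ?_
    rw [htransform s hs, mul_left_comm, Real.inv_rpow (le_of_lt hs), ← Real.rpow_neg (le_of_lt hs),
      ← Real.rpow_one_add' (le_of_lt hs) (by linarith)]
    ring_nf
  refine (isEquivalent_laplaceDefect hf hint hpos (fun t ht => by positivity)
    (isEquivalent_tailIntegral hint hc.ne' hα₁ hfα) hlim).congr_right ?_
  filter_upwards [self_mem_nhdsWithin] with s hs using htransform s hs

lemma laplaceTransform_one_sub_exp_neg_div (hs : 0 < s) :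
    laplaceTransform (fun t => (1 - Real.exp (-t)) / t) s = Real.log ((s + 1) / s) := by
  have hexp : ∀ v ≥ 0, ∫ t in Ioi (0 : ℝ), Real.exp (-(s * t)) * Real.exp (-(t * v)) = (s + v)⁻¹ :=
    fun v hv => by
      rw [← laplaceTransform_one (add_pos_of_pos_of_nonneg hs hv), laplaceTransform]
      refine integral_congr_ae (.of_forall fun t => ?_)
      simp only [← Real.exp_add, mul_one]
      ring_nf
  have hprod : Integrable (Function.uncurry fun v t => Real.exp (-(s * t)) * Real.exp (-(t * v)))
      ((volume.restrict (uIoc 0 1)).prod (volume.restrict (Ioi 0))) := by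
    have hexp_int : IntegrableOn (fun t => Real.exp (-(s * t))) (Ioi 0) := by
      simp only [← neg_mul]
      exact exp_neg_integrableOn_Ioi 0 hs
    rw [uIoc_of_le zero_le_one]
    refine (hexp_int.comp_snd (volume.restrict (Ioc 0 1))).mul_bdd (c := 1) (by fun_prop) ?_
    rw [Measure.prod_restrict]
    filter_upwards [ae_restrict_mem (measurableSet_Ioc.prod measurableSet_Ioi)] with z hz
    rw [Real.norm_of_nonneg (Real.exp_pos _).le, Real.exp_le_one_iff, neg_nonpos]
    exact mul_nonneg (le_of_lt hz.2) hz.1.1.le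
  calc laplaceTransform (fun t => (1 - Real.exp (-t)) / t) s
      = ∫ t in Ioi (0 : ℝ), ∫ v in (0 : ℝ)..1, Real.exp (-(s * t)) * Real.exp (-(t * v)) := by
        refine setIntegral_congr_fun measurableSet_Ioi fun t ht => ?_
        simp only
        rw [intervalIntegral.integral_const_mul, integral_exp_neg_mul (ne_of_gt ht), mul_one]
    _ = ∫ v in (0 : ℝ)..1, ∫ t in Ioi (0 : ℝ), Real.exp (-(s * t)) * Real.exp (-(t * v)) :=
        (intervalIntegral_integral_swap hprod).symm
    _ = ∫ v in (0 : ℝ)..1, (s + v)⁻¹ := by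
        refine intervalIntegral.integral_congr fun v hv => hexp v ?_
        exact (uIcc_of_le (zero_le_one (α := ℝ)) ▸ hv).1
    _ = Real.log ((s + 1) / s) := by
        rw [intervalIntegral.integral_comp_add_left (fun x => x⁻¹), add_zero,
          integral_inv_of_pos hs (by linarith)]

lemma isEquivalent_log_add_one_div :
    (fun s => Real.log ((s + 1) / s)) ~[𝓝[>] 0] fun s => -Real.log s := by
  have hzero : Tendsto (fun s => Real.log (s + 1)) (𝓝[>] 0) (𝓝 0) := by
    have : ContinuousAt (fun s => Real.log (s + 1)) 0 := by fun_prop (disch := norm_num)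
    simpa using this.tendsto.mono_left nhdsWithin_le_nhds
  have hsmall : (fun s : ℝ => Real.log (s + 1)) =o[𝓝[>] 0] fun s => -Real.log s :=
    (hzero.isBigO_one ℝ).trans_isLittleO ((isLittleO_one_left_iff ℝ).2
      (tendsto_norm_atTop_atTop.comp
        (tendsto_neg_atBot_atTop.comp Real.tendsto_log_nhdsGT_zero)))
  refine (IsEquivalent.refl.add_isLittleO hsmall).congr_left ?_
  filter_upwards [self_mem_nhdsWithin] with s hs
  have hs : 0 < s := hs
  rw [Real.log_div (by positivity) hs.ne', sub_eq_neg_add, Pi.add_apply]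

lemma isEquivalent_one_sub_exp_neg_div :
    (fun t => (1 - Real.exp (-t)) / t) ~[atTop] fun t : ℝ => t⁻¹ := by
  have hone : (fun t => 1 - Real.exp (-t)) ~[atTop] fun _ : ℝ => (1 : ℝ) := by
    refine (isEquivalent_const_iff_tendsto one_ne_zero).2 ?_
    simpa using Real.tendsto_exp_neg_atTop_nhds_zero.const_sub 1
  simpa only [Pi.div_def, one_div] using hone.div (IsEquivalent.refl (u := fun t : ℝ => t))

theorem isEquivalent_laplaceDefect_mul_log (hf : ∀ t > 0, 0 ≤ f t) (hint : IntegrableOn f (Ioi 0))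
    (hpos : 0 < ∫ t in Ioi (0 : ℝ), f t) (hc : 0 < c)
    (hf₂ : f ~[atTop] fun t => c * t ^ (-2 : ℝ)) :
    laplaceDefect f ~[𝓝[>] 0] fun s => c * (s * -Real.log s) := by
  have hL : laplaceTransform (fun t => c * ((1 - Real.exp (-t)) / t)) ~[𝓝[>] 0]
      fun s => c * -Real.log s := by
    refine ((IsEquivalent.refl (u := fun _ => c)).mul isEquivalent_log_add_one_div).congr_left ?_
    filter_upwards [self_mem_nhdsWithin] with s hs
    rw [laplaceTransform_const_mul, laplaceTransform_one_sub_exp_neg_div hs, Pi.mul_apply]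
  have htail : tailIntegral f ~[atTop] fun t => c * ((1 - Real.exp (-t)) / t) := by
    refine (isEquivalent_tailIntegral hint hc.ne' one_lt_two hf₂).trans
      (((IsEquivalent.refl (u := fun _ => c)).mul
        isEquivalent_one_sub_exp_neg_div.symm).congr_left (.of_forall fun t => ?_))
    norm_num [Real.rpow_neg_one]
  have hlim : Tendsto (laplaceTransform fun t => c * ((1 - Real.exp (-t)) / t)) (𝓝[>] 0) atTop :=
    hL.symm.tendsto_atTop
      ((tendsto_neg_atBot_atTop.comp Real.tendsto_log_nhdsGT_zero).const_mul_atTop hc)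
  refine ((isEquivalent_laplaceDefect hf hint hpos (fun t ht => ?_) htail hlim).trans
    ((IsEquivalent.refl (u := fun s : ℝ => s)).mul hL)).congr_right
    (.of_forall fun s => mul_left_comm _ _ _)
  have : Real.exp (-t) ≤ 1 := by simpa using ht.le
  have := sub_nonneg.2 this
  positivity

lemma integrableOn_mul_of_isBigO_rpow (hint : IntegrableOn f (Ioi 0)) (hα : 2 < α)
    (hf : f =O[atTop] fun t => t ^ (-α)) : IntegrableOn (fun t => t * f t) (Ioi 0) := by
  have hlocal : LocallyIntegrableOn (fun t => t * f t) (Ici 0) :=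
    (((integrableOn_Ici_iff_integrableOn_Ioi).2 hint).locallyIntegrableOn).continuousOn_mul
      continuousOn_id isClosed_Ici.isLocallyClosed
  have hbigO : (fun t => t * f t) =O[atTop] fun t : ℝ => t ^ (1 - α) := by
    refine ((isBigO_refl (fun t : ℝ => t) atTop).mul hf).congr' .rfl ?_
    filter_upwards [eventually_gt_atTop 0] with t ht
    rw [← Real.rpow_one_add' ht.le (by linarith), sub_eq_add_neg]
  exact (hlocal.integrableOn_of_isBigO_atTop hbigO
    (integrableAtFilter_rpow_atTop_iff.2 (by linarith))).mono_set Ioi_subset_Ici_self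

lemma one_sub_exp_neg_mul_le (s t : ℝ) : 1 - Real.exp (-(s * t)) ≤ s * t := by
  linarith [Real.add_one_le_exp (-(s * t))]

lemma laplaceDefect_le (hf : ∀ t > 0, 0 ≤ f t) (hint : IntegrableOn f (Ioi 0))
    (hmean : IntegrableOn (fun t => t * f t) (Ioi 0)) (hs : 0 ≤ s) :
    laplaceDefect f s ≤ s * ∫ t in Ioi (0 : ℝ), t * f t := by
  rw [laplaceDefect, ← integral_const_mul]
  refine setIntegral_mono_on (integrableOn_one_sub_exp_neg_mul_mul hint hs) (hmean.const_mul s)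
    measurableSet_Ioi fun t ht => ?_
  rw [← mul_assoc]
  exact mul_le_mul_of_nonneg_right (one_sub_exp_neg_mul_le s t) (hf t ht)

lemma integral_mul_pos (hf : ∀ t > 0, 0 ≤ f t) (hint : IntegrableOn f (Ioi 0))
    (hpos : 0 < ∫ t in Ioi (0 : ℝ), f t) (hmean : IntegrableOn (fun t => t * f t) (Ioi 0)) :
    0 < ∫ t in Ioi (0 : ℝ), t * f t := by
  simpa only [one_mul] using (laplaceDefect_pos hf hint hpos one_pos).trans_le
    (laplaceDefect_le hf hint hmean zero_le_one)

lemma tendsto_laplaceDefect_div (hint : IntegrableOn f (Ioi 0))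
    (hmean : IntegrableOn (fun t => t * f t) (Ioi 0)) :
    Tendsto (fun s => laplaceDefect f s / s) (𝓝[>] 0) (𝓝 (∫ t in Ioi (0 : ℝ), t * f t)) := by
  simp only [laplaceDefect, ← integral_div]
  refine tendsto_integral_filter_of_dominated_convergence (fun t => ‖t * f t‖) ?_ ?_ hmean.norm ?_
  · filter_upwards [self_mem_nhdsWithin] with s hs
    exact ((integrableOn_one_sub_exp_neg_mul_mul hint (le_of_lt hs)).div_const s).1
  · filter_upwards [self_mem_nhdsWithin] with s hs
    filter_upwards [ae_restrict_mem measurableSet_Ioi] with t ht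
    have hweight : 0 ≤ 1 - Real.exp (-(s * t)) := by
      rw [sub_nonneg, Real.exp_le_one_iff, neg_nonpos]
      exact (mul_pos hs ht).le
    rw [norm_div, norm_mul, norm_mul, Real.norm_of_nonneg hweight,
      Real.norm_of_nonneg (le_of_lt ht), Real.norm_of_nonneg (le_of_lt hs), div_le_iff₀ hs,
      mul_right_comm, mul_comm t]
    exact mul_le_mul_of_nonneg_right (one_sub_exp_neg_mul_le s t) (norm_nonneg _)
  · refine .of_forall fun t => ?_
    have hderiv : HasDerivAt (fun s => 1 - Real.exp (-(s * t))) t 0 := by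
      simpa using (((hasDerivAt_id (0 : ℝ)).mul_const t).neg.exp).const_sub 1
    have := hderiv.tendsto_slope_zero_right.mul_const (f t)
    simpa [div_eq_inv_mul, mul_assoc] using this

theorem isEquivalent_laplaceDefect_mul (hf : ∀ t > 0, 0 ≤ f t) (hint : IntegrableOn f (Ioi 0))
    (hpos : 0 < ∫ t in Ioi (0 : ℝ), f t) (hmean : IntegrableOn (fun t => t * f t) (Ioi 0)) :
    laplaceDefect f ~[𝓝[>] 0] fun s => (∫ t in Ioi (0 : ℝ), t * f t) * s := by
  have hquotient := (isEquivalent_const_iff_tendsto (integral_mul_pos hf hint hpos hmean).ne').2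
    (tendsto_laplaceDefect_div hint hmean)
  refine (hquotient.mul (IsEquivalent.refl (u := fun s : ℝ => s))).congr_left ?_
  filter_upwards [self_mem_nhdsWithin] with s hs using div_mul_cancel₀ _ (ne_of_gt hs)

end Abelian

section CriticalExponent

lemma weightedGreenFunction_ne_top {S : Type*} {p : ℝ≥0 → S → S → ℝ} {i j : S}
    (hint : IntegrableOn (fun t : ℝ => t * p t.toNNReal i j) (Ioi 0)) :
    weightedGreenFunction p i j ≠ ∞ := by
  rw [weightedGreenFunction, ← setLIntegral_congr Ioi_ae_eq_Ici]
  exact hint.lintegral_lt_top.ne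

lemma toReal_weightedGreenFunction {S : Type*} {p : ℝ≥0 → S → S → ℝ} {i j : S}
    (hp : IsTransitionFunction p)
    (hint : IntegrableOn (fun t : ℝ => t * p t.toNNReal i j) (Ioi 0)) :
    (weightedGreenFunction p i j).toReal = ∫ t in Ioi (0 : ℝ), t * p t.toNNReal i j := by
  rw [weightedGreenFunction, ← setLIntegral_congr Ioi_ae_eq_Ici,
    integral_eq_lintegral_of_nonneg_ae _ hint.1]
  filter_upwards [ae_restrict_mem measurableSet_Ioi] with t ht
  exact mul_nonneg (le_of_lt ht) (hp.nonneg _ _ _)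

variable {S Ω : Type*} [MeasurableSpace S] [MeasurableSingletonClass S] [MeasurableSpace Ω]
  {P : Measure Ω} [IsProbabilityMeasure P] {X : ℝ≥0 → Ω → S} {p : ℝ≥0 → S → S → ℝ} {i : S}
  {κ c α : ℝ}

theorem IsMarkovProcess.isRenewalFunction_expMoment (hX : IsMarkovProcess P X p i)
    (hp : IsTransitionFunction p) (hκ : 0 < κ)
    (hcrit : ENNReal.ofReal κ = 1 / greenFunction p i i) :
    IsRenewalFunction (fun t => κ * p t.toNNReal i i) (expMoment P X i κ) := by
  have hnonneg : ∀ t : ℝ, 0 ≤ p t.toNNReal i i := fun t => hp.nonneg _ _ _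
  have hmeas : AEStronglyMeasurable (fun t : ℝ => p t.toNNReal i i) (volume.restrict (Ioi 0)) :=
    (hX.measurable_returnProbability hp).aestronglyMeasurable
  have hgreen : ∫⁻ t in Ioi (0 : ℝ), ENNReal.ofReal (p t.toNNReal i i) =
      (ENNReal.ofReal κ)⁻¹ := by
    rw [hcrit, one_div, inv_inv, greenFunction, setLIntegral_congr Ioi_ae_eq_Ici]
  have hint : IntegrableOn (fun t : ℝ => p t.toNNReal i i) (Ioi 0) := by
    refine ⟨hmeas, ?_⟩
    rw [hasFiniteIntegral_iff_ofReal (.of_forall hnonneg), hgreen]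
    simpa using hκ
  have hval : ∫ t in Ioi (0 : ℝ), p t.toNNReal i i = κ⁻¹ := by
    rw [integral_eq_lintegral_of_nonneg_ae (.of_forall hnonneg) hmeas, hgreen, ENNReal.toReal_inv,
      ENNReal.toReal_ofReal hκ.le]
  refine ⟨fun t _ => mul_nonneg hκ.le (hnonneg t), hint.const_mul κ, ?_,
    hX.monotone_expMoment hκ.le |>.monotoneOn _, fun t ht => hX.expMoment_eq hp κ ht⟩
  rw [integral_const_mul, hval, mul_inv_cancel₀ hκ.ne']

lemma isEquivalent_mul_toNNReal {q : ℝ≥0 → ℝ}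
    (hq : q ~[atTop] fun t : ℝ≥0 => c * (t : ℝ) ^ (-α)) (κ : ℝ) :
    (fun t => κ * q t.toNNReal) ~[atTop] fun t => κ * c * t ^ (-α) := by
  refine ((IsEquivalent.refl (u := fun _ => κ)).mul
    (hq.comp_tendsto tendsto_real_toNNReal_atTop)).congr_right ?_
  filter_upwards [eventually_ge_atTop 0] with t ht
  simp only [Pi.mul_apply, Function.comp_apply, Real.coe_toNNReal t ht, mul_assoc]

variable {φ M : ℝ → ℝ}

theorem IsRenewalFunction.isEquivalent_of_lt_two (h : IsRenewalFunction φ M) (hc : 0 < c)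
    (hα₁ : 1 < α) (hα₂ : α < 2) (hφ : φ ~[atTop] fun t => c * t ^ (-α)) :
    M ~[atTop] fun t => t ^ (α - 1) * ((α - 1) / (c * Real.Gamma (2 - α) * Real.Gamma α)) := by
  have hΓ := Real.Gamma_pos_of_pos (sub_pos.2 hα₂)
  have hα : 0 < α - 1 := sub_pos.2 hα₁
  refine (h.isEquivalent_atTop (by linarith) (isEquivalent_laplaceDefect_rpow h.density_nonneg
    h.density_integrable (h.density_integral ▸ one_pos) hc hα₁ hα₂ hφ)
    ((IsRegularlyVaryingAtZero.rpow (α - 1)).const_mul (by positivity))).congr_right ?_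
  filter_upwards [eventually_gt_atTop 0] with t ht
  have := Real.rpow_pos_of_pos ht (α - 1)
  rw [sub_add_cancel, Real.inv_rpow ht.le]
  field_simp

theorem IsRenewalFunction.isEquivalent_of_eq_two (h : IsRenewalFunction φ M) (hc : 0 < c)
    (hφ : φ ~[atTop] fun t => c * t ^ (-2 : ℝ)) :
    M ~[atTop] fun t => t / Real.log t * (1 / c) := by
  have hrv := (IsRegularlyVaryingAtZero.self.mul .neg_log).const_mul hc.ne'
  rw [add_zero] at hrv
  refine (h.isEquivalent_atTop (by norm_num) (isEquivalent_laplaceDefect_mul_log h.density_nonneg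
    h.density_integrable (h.density_integral ▸ one_pos) hc hφ) hrv).congr_right
      (.of_forall fun t => ?_)
  dsimp only
  rw [one_add_one_eq_two, Real.Gamma_two, Real.log_inv, neg_neg]
  field_simp

theorem IsRenewalFunction.isEquivalent_of_integrableOn_mul (h : IsRenewalFunction φ M)
    (hmean : IntegrableOn (fun t => t * φ t) (Ioi 0)) :
    M ~[atTop] fun t => t * (1 / ∫ t in Ioi (0 : ℝ), t * φ t) := by
  have hpos := h.density_integral ▸ one_pos
  have hmean_pos := integral_mul_pos h.density_nonneg h.density_integrable hpos hmean
  refine (h.isEquivalent_atTop (by norm_num) (isEquivalent_laplaceDefect_mul h.density_nonneg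
    h.density_integrable hpos hmean)
    (IsRegularlyVaryingAtZero.self.const_mul hmean_pos.ne')).congr_right (.of_forall fun t => ?_)
  dsimp only
  rw [one_add_one_eq_two, Real.Gamma_two, one_mul, mul_inv, inv_inv, one_div, mul_comm]

end CriticalExponent

end CriticalLocalTime

open CriticalLocalTime in
theorem mainTheorem9_general {S : Type*} [MeasurableSpace S] [MeasurableSingletonClass S]
    {Ω : Type*} [MeasurableSpace Ω] (P : Measure Ω) [IsProbabilityMeasure P]
    (p : ℝ≥0 → S → S → ℝ) (X : ℝ≥0 → Ω → S) (i : S)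
    (hp : IsTransitionFunction p) (hX : IsMarkovProcess P X p i) (c α : ℝ) (hc : 0 < c)
    (hpα : (fun t : ℝ≥0 => p t i i) ~[atTop] fun t : ℝ≥0 => c * (t : ℝ) ^ (-α))
    (κ : ℝ) (hκ : 0 < κ) (hcrit : ENNReal.ofReal κ = 1 / greenFunction p i i) :
    (1 < α → α < 2 →
      (fun t : ℝ≥0 => ∫ ω, Real.exp (κ * localTime X i t ω) ∂P) ~[atTop]
        fun t : ℝ≥0 => (t : ℝ) ^ (α - 1) *
          ((α - 1) / (κ * c * Real.Gamma (2 - α) * Real.Gamma α))) ∧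
    (α = 2 →
      (fun t : ℝ≥0 => ∫ ω, Real.exp (κ * localTime X i t ω) ∂P) ~[atTop]
        fun t : ℝ≥0 => (t : ℝ) / Real.log t * (1 / (κ * c))) ∧
    (2 < α →
      weightedGreenFunction p i i ≠ ∞ ∧
      (fun t : ℝ≥0 => ∫ ω, Real.exp (κ * localTime X i t ω) ∂P) ~[atTop]
        fun t : ℝ≥0 => (t : ℝ) * (1 / (κ * (weightedGreenFunction p i i).toReal))) := by
  have hrenewal := hX.isRenewalFunction_expMoment hp hκ hcrit
  have hdensity := isEquivalent_mul_toNNReal hpα κ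
  have hcoe : Tendsto (fun t : ℝ≥0 => (t : ℝ)) atTop atTop := NNReal.tendsto_coe_atTop.2 tendsto_id
  refine ⟨fun hα₁ hα₂ => ?_, fun hα => ?_, fun hα => ?_⟩
  · exact (hrenewal.isEquivalent_of_lt_two (mul_pos hκ hc) hα₁ hα₂ hdensity).comp_tendsto hcoe
  · subst hα
    exact (hrenewal.isEquivalent_of_eq_two (mul_pos hκ hc) hdensity).comp_tendsto hcoe
  · have hmean := integrableOn_mul_of_isBigO_rpow hrenewal.density_integrable hα
      (hdensity.isBigO.trans (isBigO_const_mul_self _ _ _))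
    have hfactor : ∀ t : ℝ, t * (κ * p t.toNNReal i i) = κ * (t * p t.toNNReal i i) :=
      fun t => mul_left_comm _ _ _
    have hequiv := (hrenewal.isEquivalent_of_integrableOn_mul hmean).comp_tendsto hcoe
    simp only [hfactor, integral_const_mul] at hmean hequiv
    have hmean_p := (integrable_const_mul_iff hκ.ne'.isUnit _).1 hmean
    rw [toReal_weightedGreenFunction hp hmean_p]
    exact ⟨weightedGreenFunction_ne_top hmean_p, hequiv⟩

theorem mainTheorem9 {S : Type*} [Countable S] [MeasurableSpace S] [DiscreteMeasurableSpace S]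
    {Ω : Type*} [MeasurableSpace Ω] (P : Measure Ω) [IsProbabilityMeasure P]
    (a : S → S → ℝ) (p : ℝ≥0 → S → S → ℝ) (X : ℝ≥0 → Ω → S) (i : S)
    (hp : CriticalLocalTime.IsTransitionFunction p)
    (ha : CriticalLocalTime.HasTransitionRates a p)
    (hX : CriticalLocalTime.IsMarkovProcess P X p i)
    (c α : ℝ) (hc : 0 < c)
    (hpα : (fun t : ℝ≥0 => p t i i) ~[atTop] fun t : ℝ≥0 => c * (t : ℝ) ^ (-α))
    (κ : ℝ) (hκ : 0 < κ)
    (hcrit : ENNReal.ofReal κ = 1 / CriticalLocalTime.greenFunction p i i) :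
    (1 < α → α < 2 →
      (fun t : ℝ≥0 => ∫ ω, Real.exp (κ * CriticalLocalTime.localTime X i t ω) ∂P) ~[atTop]
        fun t : ℝ≥0 => (t : ℝ) ^ (α - 1) *
          ((α - 1) / (κ * c * Real.Gamma (2 - α) * Real.Gamma α))) ∧
    (α = 2 →
      (fun t : ℝ≥0 => ∫ ω, Real.exp (κ * CriticalLocalTime.localTime X i t ω) ∂P) ~[atTop]
        fun t : ℝ≥0 => (t : ℝ) / Real.log t * (1 / (κ * c))) ∧
    (2 < α →
      CriticalLocalTime.weightedGreenFunction p i i ≠ ∞ ∧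
      (fun t : ℝ≥0 => ∫ ω, Real.exp (κ * CriticalLocalTime.localTime X i t ω) ∂P) ~[atTop]
        fun t : ℝ≥0 => (t : ℝ) *
          (1 / (κ * (CriticalLocalTime.weightedGreenFunction p i i).toReal))) :=
  mainTheorem9_general P p X i hp hX c α hc hpα κ hκ hcrit
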